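/- **Theorem (Operational Correspondence).** *Parameters.* Fix a set of node identifiers, a set of action labels $f$, a logic of conditions $c,o,i$ on node states with a conjunction, where $s\models c_1\wedge c_2$ iff $s\models c_1$ and $s\models c_2$, and arbitrary side-effect functions $f^d!(s,id')$, $f^d?(s,id)$ on states. A state $s$ is a register containing the node's identifier $id(s)$, its power provider $i(s)$, the status of the input link, the set $n(s)$ of neighbours, and the capacity and the numbers of active and of faulty links. A network state $\Delta$ is a finite nonempty map from identifiers to states; throughout, $\Delta(id)\models c$ includes that $id\in dom(\Delta)$. *Global language.* $P::=\mathbf 0\mid P|P\mid \mu X.P\mid X\mid S\mid (id)P$, $S::= [o]f^d[i].P\mid S+S$, with directions $d$: $\star$ (all children), $\blacktriangle$ (parent), $\blacktriangleright$ (a neighbour), $\circlearrowleft$ (the node itself). Protocols are identified up to renaming of bound variables. Structural congruence $\equiv$ is the least congruence such that $|$ and $+$ are associative and commutative, $P|\mathbf 0\equiv P$, $\mu X.P\equiv P[\mu X.P/X]$, $(id)(P|Q)\equiv (id)P|(id)Q$, $(id_1)(id_2)P\equiv(id_2)(id_1)P$, $(id)\mathbf 0\equiv\mathbf 0$. Reduction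 $\Delta\triangleright P\to\Delta'\triangleright Q$ is the least relation that is closed under the contexts $[o]f^d[i].\,\cdot$, $(id)\,\cdot$, $\cdot+S$, $\cdot\,|\,P$ and, on both sides, under $\equiv$, and that contains the following steps (in which the summand $S$ may be absent): - (binary) $\Delta\triangleright(id)([o]f^d[i].P+S)\to\Delta'\triangleright[o]f^d[i].(id')P+S$ if $\Delta(id)\models o$, $\Delta(id')\models i$, $id\ne id'$, and either $d=\blacktriangle$ and $id'=i(\Delta(id))$, or $d=\blacktriangleright$ and $id'\in n(\Delta(id))$; here $\Delta'=\Delta[id\mapsto f^d!(\Delta(id),id'),\,id'\mapsto f^d?(\Delta(id'),id)]$; - (broadcast) $\Delta\triangleright(id)([o]f^\star[i].P+S)\to\Delta\triangleright[o]f^\star[i].(id_1)\cdots(id_m)P+S$ if $\Delta(id)\models o$ and $id_1,\dots,id_m$ ($m\ge 0$) are, without repetition, all the nodes of $dom(\Delta)$ whose parent is $id$ and whose state satisfies $i$; - (local) $\Delta\triangleright(id)([o]f^\circlearrowleft[i].P+S)\to\Delta\triangleright[o]f^\circlearrowleft[i].(id)P+S$ if $\Delta(id)\models o$ and $\Delta(id)\models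 i$. *Well-formedness.* A specification is a closed protocol in which the construct $(id)\,\cdot$ occurs only at top level (not under actions, summations or recursions), all action labels are distinct, and recursion is guarded (in each $\mu X.P$ the variable $X$ occurs in $P$ only below synchronisation actions). A protocol is well-formed if, up to $\equiv$, it is reached from a specification by finitely many (possibly zero) reductions, starting in some network state. A network state $\Delta$ is well-formed if $id(\Delta(id))=id$ and $i(\Delta(id))\neq id$ for all $id\in dom(\Delta)$. *Networks.* $D::=[c]f^d?.R\mid R\mid D|D$, $R::=C\mid\mathbf 0\mid R|R$, $C::=[c]f^d!\mid C+C$, $N::= s[D]\mid N\|N$. Definitions have the transitions $[c]f^d?.R\xrightarrow{[c]f^d?}R\,|\,[c]f^d?.R$ and $[c]f^d!\xrightarrow{[c]f^d!}\mathbf 0$; a choice moves as either summand, discarding the other; $D_1|D_2$ moves as either component, or by $\xrightarrow{[c_1\wedge c_2]f}$ when one component does $[c_1]f^\circlearrowleft!$ and the other $[c_2]f^\circlearrowleft?$. A node $s[D]$, where $D\to D'$ by the indicated action and $s\models c$, has the transitions - $\xrightarrow{\tau}s[D']$, for $[c]f$; - $\xrightarrow{(id(s)\to id)^f}f^d!(s,id)[D']$,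 for $[c]f^d!$ with $d=\blacktriangle$ and $id=i(s)$, or $d=\blacktriangleright$ and $id\in n(s)$; - $\xrightarrow{(id(s)\leftarrow id)^f}f^d?(s,id)[D']$, for $[c]f^d?$ with $d\in\{\blacktriangle,\blacktriangleright\}$ and any $id$; - $\xrightarrow{id(s)!\star^f}s[D']$, for $[c]f^\star!$, and $\xrightarrow{i(s)?\star^f}s[D']$, for $[c]f^\star?$; moreover $s[D]\xrightarrow{id?\star^f}s[D]$ whenever it is not the case that $i(s)=id$ and $D\xrightarrow{[c]f^\star?}D'$ for some $D'$ and some $c$ with $s\models c$. In $N_1\|N_2$ one component may move alone if the label is not a broadcast label $id!\star^f$ or $id?\star^f$; both move together by $(id_1\to id_2)^f$ and $(id_2\leftarrow id_1)^f$, giving $\tau$, by $id!\star^f$ and $id?\star^f$, giving $id!\star^f$, or both by $id?\star^f$, giving $id?\star^f$ (and symmetrically). Structural congruence $\equiv$ of definitions and networks is the least congruence such that $|$, $+$ and $\|$ are associative and commutative, $D|\mathbf 0\equiv D$ and $[c]f^d?.R\,|\,[c]f^d?.R\equiv[c]f^d?.R$. *Projection.* For $r$ being $!$ (enabling), $?$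 (reactive) or an identifier $id$ (active), and $\sigma$ a mapping from recursion variables to protocols, $\llbracket P\rrbracket^r_\sigma$ is given by: $\llbracket[o]f^d[i].P\rrbracket^?_\sigma=[i]f^d?.\llbracket P\rrbracket^!_\sigma\,|\,\llbracket P\rrbracket^?_\sigma$; $\llbracket[o]f^d[i].P\rrbracket^!_\sigma=[o]f^d!$; $\llbracket[o]f^d[i].P\rrbracket^{id}_\sigma=\llbracket P\rrbracket^{id}_\sigma$; $\llbracket(id)P\rrbracket^{id}_\sigma=\llbracket P\rrbracket^{id}_\sigma\,|\,\llbracket P\rrbracket^!_\sigma$; $\llbracket(id)P\rrbracket^r_\sigma=\llbracket P\rrbracket^r_\sigma$ for $r\ne id$; $\llbracket\mathbf 0\rrbracket^r_\sigma=\mathbf 0$; $\llbracket X\rrbracket^r_\sigma=\mathbf 0$ for $r\neq\,!$; $\llbracket X\rrbracket^!_\sigma=\llbracket\sigma(X)\rrbracket^!_\sigma$; $\llbracket\mu X.P\rrbracket^r_\sigma=\llbracket P\rrbracket^r_{\sigma[X\mapsto P]}$; $\llbracket P|Q\rrbracket^r_\sigma=\llbracket P\rrbracket^r_\sigma\,|\,\llbracket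 Q\rrbracket^r_\sigma$; $\llbracket S_1+S_2\rrbracket^!_\sigma=\llbracket S_1\rrbracket^!_\sigma+\llbracket S_2\rrbracket^!_\sigma$; $\llbracket S_1+S_2\rrbracket^r_\sigma=\llbracket S_1\rrbracket^r_\sigma\,|\,\llbracket S_2\rrbracket^r_\sigma$ for $r\neq\,!$ (bound variables being chosen distinct). The projection $\llbracket\Delta\triangleright P\rrbracket$ of a configuration is the parallel composition, over all $id\in dom(\Delta)$, of the nodes $\Delta(id)\big[\llbracket P\rrbracket^?_\emptyset\,|\,\llbracket P\rrbracket^{id}_\emptyset\big]$. *Claim.* Let $P$ be a well-formed protocol and $\Delta$ a well-formed network state. 1. (Soundness) For all $\Delta',Q$: if $\Delta\triangleright P\to\Delta'\triangleright Q$, then there are a label $\hat\lambda$ that is $\tau$ or of the form $id!\star^f$ and a network $N$ such that $\llbracket\Delta\triangleright P\rrbracket\xrightarrow{\hat\lambda}N$ and $N\equiv\llbracket\Delta'\triangleright Q\rrbracket$. 2. (Completeness) For all $N$ and all labels $\hat\lambda$ that are $\tau$ or of the form $id!\star^f$: if $\llbracket\Delta\triangleright P\rrbracket\xrightarrow{\hat\lambda}N$,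 then there are $\Delta',Q$ such that $\Delta\triangleright P\to\Delta'\triangleright Q$ and $N\equiv\llbracket\Delta'\triangleright Q\rrbracket$. -/

import Mathlib

universe u v w

namespace OpControl

/-! ### Network states and the parameters of the model -/

/-- The direction of a synchronisation: all children, the power provider, a neighbour, the node
itself. -/
inductive Dir where
  | star
  | up
  | right
  | self

/-- The state register of a node. -/
structure State (Id : Type u) where
  /-- the identifier of the node itself -/
  self : Id
  /-- the identifier of the power provider (the parent) -/
  source : Id
  /-- the status of the input power connection -/
  status : Bool
  /-- the identifiers of the neighbours -/
  neighbours : Set Id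
  /-- the power supply capacity -/
  capacity : ℕ
  /-- the number of active power supply links -/
  active : ℕ
  /-- the number of faulty power supply links -/
  faulty : ℕ

/-- The parameters that the language leaves open: an arbitrary logic of conditions on states (in
which conditions can be conjoined), and arbitrary side-effects of the synchronisation actions on
the states of the enabling and of the reacting node. The last argument of a side-effect is the
identifier of the partner. -/
structure Model (Id : Type u) (Label : Type v) where
  Cond : Type w
  Sat : State Id → Cond → Prop
  conj : Cond → Cond → Cond
  sat_conj : ∀ s c₁ c₂, Sat s (conj c₁ c₂) ↔ Sat s c₁ ∧ Sat s c₂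
  effOut : Label → Dir → State Id → Id → State Id
  effIn : Label → Dir → State Id → Id → State Id

/-- A network state: a finite (nonempty) mapping from node identifiers to states. -/
structure NetState (Id : Type u) where
  map : Finmap (fun _ : Id => State Id)
  nonempty : map.entries.toList ≠ []

namespace NetState

variable {Id : Type u} [DecidableEq Id]

/-- The state of a node, if the node is in the domain. -/
def lookup (Δ : NetState Id) (id : Id) : Option (State Id) := Δ.map.lookup id

/-- Overwrite the state of one node. -/
def set (Δ : NetState Id) (id : Id) (s : State Id) : NetState Id where
  map := Δ.map.insert id s
  nonempty := by
    intro h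
    have h1 : id ∈ Δ.map.insert id s := by simp
    rw [Finmap.mem_def] at h1
    rw [Multiset.toList_eq_nil] at h
    simp [h] at h1

/-- The side-effects on the network state of a binary synchronisation on `f` in direction `d`
between two different nodes of the domain, `id` (enabling, in state `s`) and `id'` (reacting, in
state `s'`). -/
def upd {Label : Type v} (M : Model.{u, v, w} Id Label) (f : Label) (d : Dir)
    (id : Id) (s : State Id) (id' : Id) (s' : State Id) (Δ : NetState Id) : NetState Id :=
  (Δ.set id (M.effOut f d s id')).set id' (M.effIn f d s' id)

/-- Every register carries the identifier of the node it is assigned to, and no node is its own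
power provider. -/
def WellFormed (Δ : NetState Id) : Prop :=
  ∀ id s, Δ.lookup id = some s → s.self = id ∧ s.source ≠ id

end NetState

/-! ### The global language. Recursion variables are de Bruijn indices. -/

mutual
  /-- Protocols. -/
  inductive Proto (Id : Type u) (Label : Type v) (Cond : Type w) : Type (max u v w) where
    | nil : Proto Id Label Cond
    | par : Proto Id Label Cond → Proto Id Label Cond → Proto Id Label Cond
    | mu : Proto Id Label Cond → Proto Id Label Cond
    | var : ℕ → Proto Id Label Cond
    | sum : Summ Id Label Cond → Proto Id Label Cond
    | act : Id → Proto Id Label Cond → Proto Id Label Cond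
  /-- Summations of synchronisation actions; `pre f d o i P` is the action `f` in direction `d`
  with enabling condition `o`, reacting condition `i` and continuation `P`. -/
  inductive Summ (Id : Type u) (Label : Type v) (Cond : Type w) : Type (max u v w) where
    | pre : Label → Dir → Cond → Cond → Proto Id Label Cond → Summ Id Label Cond
    | plus : Summ Id Label Cond → Summ Id Label Cond → Summ Id Label Cond
end

/-- Extend an assignment to recursion variables by a value for the innermost variable. -/
def scons {α : Type*} (a : α) (ρ : ℕ → α) : ℕ → α
  | 0 => a
  | n + 1 => ρ n

section Global

variable {Id : Type u} {Label : Type v} {Cond : Type w}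

mutual
  /-- Renaming of recursion variables. -/
  def Proto.rename (ξ : ℕ → ℕ) : Proto Id Label Cond → Proto Id Label Cond
    | .nil => .nil
    | .par P Q => .par (P.rename ξ) (Q.rename ξ)
    | .mu P => .mu (P.rename (scons 0 fun n => ξ n + 1))
    | .var n => .var (ξ n)
    | .sum S => .sum (S.rename ξ)
    | .act id P => .act id (P.rename ξ)
  /-- Renaming of recursion variables. -/
  def Summ.rename (ξ : ℕ → ℕ) : Summ Id Label Cond → Summ Id Label Cond
    | .pre f d o i P => .pre f d o i (P.rename ξ)
    | .plus S T => .plus (S.rename ξ) (T.rename ξ)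
end

mutual
  /-- Capture-avoiding simultaneous substitution of protocols for recursion variables. -/
  def Proto.subst (τ : ℕ → Proto Id Label Cond) : Proto Id Label Cond → Proto Id Label Cond
    | .nil => .nil
    | .par P Q => .par (P.subst τ) (Q.subst τ)
    | .mu P => .mu (P.subst (scons (.var 0) fun n => (τ n).rename Nat.succ))
    | .var n => τ n
    | .sum S => .sum (S.subst τ)
    | .act id P => .act id (P.subst τ)
  /-- Capture-avoiding simultaneous substitution of protocols for recursion variables. -/
  def Summ.subst (τ : ℕ → Proto Id Label Cond) : Summ Id Label Cond → Summ Id Label Cond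
    | .pre f d o i P => .pre f d o i (P.subst τ)
    | .plus S T => .plus (S.subst τ) (T.subst τ)
end

/-- The unfolding of the recursion with body `P`: replace the variable by the recursion itself. -/
def Proto.unfold (P : Proto Id Label Cond) : Proto Id Label Cond :=
  P.subst (scons (.mu P) .var)

/-- All nodes of a set (given as a list without repetitions) are active on a protocol. -/
def Proto.acts (I : List Id) (P : Proto Id Label Cond) : Proto Id Label Cond :=
  I.foldr Proto.act P

/-- Add a further summand, which may be absent. -/
def Summ.plusOpt (S : Summ Id Label Cond) : Option (Summ Id Label Cond) → Summ Id Label Cond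
  | none => S
  | some T => .plus S T

/-- Structural congruence of protocols. -/
inductive SCong : Proto Id Label Cond → Proto Id Label Cond → Prop
  | refl (P) : SCong P P
  | symm {P Q} : SCong P Q → SCong Q P
  | trans {P Q R} : SCong P Q → SCong Q R → SCong P R
  -- closure under the operators of the language
  | par_congr {P P' Q Q'} : SCong P P' → SCong Q Q' → SCong (.par P Q) (.par P' Q')
  | mu_congr {P P'} : SCong P P' → SCong (.mu P) (.mu P')
  | act_congr (id) {P P'} : SCong P P' → SCong (.act id P) (.act id P')
  | pre_congr (f d o i) {P P'} : SCong P P' →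
      SCong (.sum (.pre f d o i P)) (.sum (.pre f d o i P'))
  | plus_congr {S S' T T'} : SCong (.sum S) (.sum S') → SCong (.sum T) (.sum T') →
      SCong (.sum (.plus S T)) (.sum (.plus S' T'))
  -- axioms
  | par_nil (P) : SCong (.par P .nil) P
  | par_assoc (P Q R) : SCong (.par P (.par Q R)) (.par (.par P Q) R)
  | par_comm (P Q) : SCong (.par P Q) (.par Q P)
  | mu_unfold (P) : SCong (.mu P) P.unfold
  | plus_assoc (S T U) : SCong (.sum (.plus S (.plus T U))) (.sum (.plus (.plus S T) U))
  | plus_comm (S T) : SCong (.sum (.plus S T)) (.sum (.plus T S))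
  | act_par (id P Q) : SCong (.act id (.par P Q)) (.par (.act id P) (.act id Q))
  | act_act (id₁ id₂ P) : SCong (.act id₁ (.act id₂ P)) (.act id₂ (.act id₁ P))
  | act_nil (id) : SCong (.act id .nil) .nil

/-- `BinTarget d s id'`: the node `id'` is a possible target of a binary synchronisation in
direction `d` of a node in state `s`. -/
def BinTarget : Dir → State Id → Id → Prop
  | .up, s, id' => s.source = id'
  | .right, s, id' => id' ∈ s.neighbours
  | .star, _, _ => False
  | .self, _, _ => False

end Global

/-- Reduction of configurations: `Red M Δ P Δ' P'` is `Δ ▷ P ⟶ Δ' ▷ P'`. -/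
inductive Red {Id : Type u} {Label : Type v} [DecidableEq Id] (M : Model.{u, v, w} Id Label) :
    NetState Id → Proto Id Label M.Cond → NetState Id → Proto Id Label M.Cond → Prop
  | bin {Δ id id' s s' f d o i P S} :
      Δ.lookup id = some s → M.Sat s o →
      BinTarget d s id' →
      Δ.lookup id' = some s' → M.Sat s' i →
      id ≠ id' →
      Red M Δ (.act id (.sum ((Summ.pre f d o i P).plusOpt S)))
        (Δ.upd M f d id s id' s') (.sum ((Summ.pre f d o i (.act id' P)).plusOpt S))
  | brd {Δ id s f o i P S I} :
      Δ.lookup id = some s → M.Sat s o →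
      I.Nodup →
      (∀ id', id' ∈ I ↔ ∃ s', Δ.lookup id' = some s' ∧ s'.source = id ∧ M.Sat s' i) →
      Red M Δ (.act id (.sum ((Summ.pre f .star o i P).plusOpt S)))
        Δ (.sum ((Summ.pre f .star o i (P.acts I)).plusOpt S))
  | loc {Δ id s f o i P S} :
      Δ.lookup id = some s → M.Sat s o → M.Sat s i →
      Red M Δ (.act id (.sum ((Summ.pre f .self o i P).plusOpt S)))
        Δ (.sum ((Summ.pre f .self o i (.act id P)).plusOpt S))
  | synch {Δ Δ' f d o i P P'} : Red M Δ P Δ' P' →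
      Red M Δ (.sum (.pre f d o i P)) Δ' (.sum (.pre f d o i P'))
  | act {Δ Δ' id P P'} : Red M Δ P Δ' P' → Red M Δ (.act id P) Δ' (.act id P')
  | sum {Δ Δ' S S' T} : Red M Δ (.sum S) Δ' (.sum S') →
      Red M Δ (.sum (.plus S T)) Δ' (.sum (.plus S' T))
  | par {Δ Δ' P P' Q} : Red M Δ P Δ' P' → Red M Δ (.par P Q) Δ' (.par P' Q)
  | struct {Δ Δ' P P' Q' Q} : SCong P P' → Red M Δ P' Δ' Q' → SCong Q' Q → Red M Δ P Δ' Q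

/-! ### Well-formed protocols -/

section WellFormed

variable {Id : Type u} {Label : Type v} {Cond : Type w}

mutual
  /-- There is no active node construct. -/
  def Proto.Static : Proto Id Label Cond → Prop
    | .nil => True
    | .par P Q => P.Static ∧ Q.Static
    | .mu P => P.Static
    | .var _ => True
    | .sum S => S.Static
    | .act _ _ => False
  /-- There is no active node construct. -/
  def Summ.Static : Summ Id Label Cond → Prop
    | .pre _ _ _ _ P => P.Static
    | .plus S T => S.Static ∧ T.Static
end

/-- The active node construct appears at top level only. -/
inductive Proto.TopActive : Proto Id Label Cond → Prop
  | static {P : Proto Id Label Cond} : P.Static → P.TopActive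
  | act {P : Proto Id Label Cond} (id : Id) : P.TopActive → (Proto.act id P).TopActive
  | par {P Q : Proto Id Label Cond} : P.TopActive → Q.TopActive → (Proto.par P Q).TopActive

mutual
  /-- All free recursion variables are below `n` (for `n = 0`: the protocol is closed). -/
  def Proto.ClosedBelow (n : ℕ) : Proto Id Label Cond → Prop
    | .nil => True
    | .par P Q => P.ClosedBelow n ∧ Q.ClosedBelow n
    | .mu P => P.ClosedBelow (n + 1)
    | .var m => m < n
    | .sum S => S.ClosedBelow n
    | .act _ P => P.ClosedBelow n
  /-- All free recursion variables are below `n`. -/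
  def Summ.ClosedBelow (n : ℕ) : Summ Id Label Cond → Prop
    | .pre _ _ _ _ P => P.ClosedBelow n
    | .plus S T => S.ClosedBelow n ∧ T.ClosedBelow n
end

/-- The variable `n` occurs only below synchronisation actions. -/
def Proto.VarGuarded (n : ℕ) : Proto Id Label Cond → Prop
  | .nil => True
  | .par P Q => P.VarGuarded n ∧ Q.VarGuarded n
  | .mu P => P.VarGuarded (n + 1)
  | .var m => m ≠ n
  | .sum _ => True
  | .act _ P => P.VarGuarded n

mutual
  /-- All recursions are guarded. -/
  def Proto.Guarded : Proto Id Label Cond → Prop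
    | .nil => True
    | .par P Q => P.Guarded ∧ Q.Guarded
    | .mu P => P.VarGuarded 0 ∧ P.Guarded
    | .var _ => True
    | .sum S => S.Guarded
    | .act _ P => P.Guarded
  /-- All recursions are guarded. -/
  def Summ.Guarded : Summ Id Label Cond → Prop
    | .pre _ _ _ _ P => P.Guarded
    | .plus S T => S.Guarded ∧ T.Guarded
end

mutual
  /-- The action labels, with multiplicity. -/
  def Proto.labels : Proto Id Label Cond → List Label
    | .nil => []
    | .par P Q => P.labels ++ Q.labels
    | .mu P => P.labels
    | .var _ => []
    | .sum S => S.labels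
    | .act _ P => P.labels
  /-- The action labels, with multiplicity. -/
  def Summ.labels : Summ Id Label Cond → List Label
    | .pre f _ _ _ P => f :: P.labels
    | .plus S T => S.labels ++ T.labels
end

/-- Specifications: closed protocols in which active nodes appear at top level only, all action
labels are distinct and recursion is guarded. -/
structure Proto.IsSpec (P : Proto Id Label Cond) : Prop where
  closed : P.ClosedBelow 0
  topActive : P.TopActive
  labels_nodup : P.labels.Nodup
  guarded : P.Guarded

end WellFormed

/-- A protocol is well-formed if it originates from a specification: it is reached from it by
reductions, up to structural congruence. -/
def Proto.WellFormed {Id : Type u} {Label : Type v} [DecidableEq Id] (M : Model.{u, v, w} Id Label)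
    (P : Proto Id Label M.Cond) : Prop :=
  ∃ (Δ₀ Δ₁ : NetState Id) (P₀ P₁ : Proto Id Label M.Cond), P₀.IsSpec ∧
    Relation.ReflTransGen
      (fun c c' : NetState Id × Proto Id Label M.Cond => Red M c.1 c.2 c'.1 c'.2)
      (Δ₀, P₀) (Δ₁, P₁) ∧
    SCong P₁ P

/-! ### The distributed language -/

/-- Choices between outputs; `out c f d` enables the action `f` in direction `d` under the condition
`c`. -/
inductive Choice (Label : Type v) (Cond : Type w) : Type (max v w) where
  | out : Cond → Label → Dir → Choice Label Cond
  | plus : Choice Label Cond → Choice Label Cond → Choice Label Cond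

/-- Reactions. -/
inductive Reaction (Label : Type v) (Cond : Type w) : Type (max v w) where
  | nil : Reaction Label Cond
  | choice : Choice Label Cond → Reaction Label Cond
  | par : Reaction Label Cond → Reaction Label Cond → Reaction Label Cond

/-- Definitions; `inp c f d R` is the persistent input on `f` in direction `d`, under the condition `c`
and with continuation `R`. The reactions are the definitions without inputs, see `Reaction.toDefn`. -/
inductive Defn (Label : Type v) (Cond : Type w) : Type (max v w) where
  | inp : Cond → Label → Dir → Reaction Label Cond → Defn Label Cond
  | nil : Defn Label Cond
  | choice : Choice Label Cond → Defn Label Cond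
  | par : Defn Label Cond → Defn Label Cond → Defn Label Cond

/-- A reaction, seen as a definition. -/
def Reaction.toDefn {Label : Type v} {Cond : Type w} : Reaction Label Cond → Defn Label Cond
  | .nil => .nil
  | .choice C => .choice C
  | .par R R' => .par R.toDefn R'.toDefn

/-- Networks. -/
inductive Network (Id : Type u) (Label : Type v) (Cond : Type w) : Type (max u v w) where
  | node : State Id → Defn Label Cond → Network Id Label Cond
  | par : Network Id Label Cond → Network Id Label Cond → Network Id Label Cond

/-- The parallel composition of a nonempty list of networks. -/
def Network.ofList {Id : Type u} {Label : Type v} {Cond : Type w} :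
    (L : List (Network Id Label Cond)) → L ≠ [] → Network Id Label Cond
  | [], h => absurd rfl h
  | [N], _ => N
  | N :: N' :: L, _ => .par N (Network.ofList (N' :: L) (List.cons_ne_nil N' L))

/-- Actions of definitions: reacting, enabling, and local computation. -/
inductive Action (Label : Type v) (Cond : Type w) : Type (max v w) where
  | inp : Cond → Label → Dir → Action Label Cond
  | out : Cond → Label → Dir → Action Label Cond
  | loc : Cond → Label → Action Label Cond

/-- The labelled transition system of definitions. -/
inductive DStep {Id : Type u} {Label : Type v} (M : Model.{u, v, w} Id Label) :
    Defn Label M.Cond → Action Label M.Cond → Defn Label M.Cond → Prop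
  | inp (c f d R) : DStep M (.inp c f d R) (.inp c f d) (.par R.toDefn (.inp c f d R))
  | out (c f d) : DStep M (.choice (.out c f d)) (.out c f d) .nil
  | sum_left {C₁ C₂ α D} : DStep M (.choice C₁) α D → DStep M (.choice (.plus C₁ C₂)) α D
  | sum_right {C₁ C₂ α D} : DStep M (.choice C₂) α D → DStep M (.choice (.plus C₁ C₂)) α D
  | int_left {D₁ D₂ α D₁'} : DStep M D₁ α D₁' → DStep M (.par D₁ D₂) α (.par D₁' D₂)
  | int_right {D₁ D₂ α D₂'} : DStep M D₂ α D₂' → DStep M (.par D₁ D₂) α (.par D₁ D₂')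
  | self_left {D₁ D₂ D₁' D₂' c₁ c₂ f} :
      DStep M D₁ (.out c₁ f .self) D₁' → DStep M D₂ (.inp c₂ f .self) D₂' →
      DStep M (.par D₁ D₂) (.loc (M.conj c₁ c₂) f) (.par D₁' D₂')
  | self_right {D₁ D₂ D₁' D₂' c₁ c₂ f} :
      DStep M D₁ (.inp c₂ f .self) D₁' → DStep M D₂ (.out c₁ f .self) D₂' →
      DStep M (.par D₁ D₂) (.loc (M.conj c₁ c₂) f) (.par D₁' D₂')

/-- Labels of network transitions. `send id₁ id₂ f` is the binary link from `id₁` to `id₂`,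
enabled by `id₁`; `recv id₁ id₂ f` says that `id₁` reacts to `id₂`; `bsend id f` is the broadcast of
`id` to its children, and `brecv id f` the reaction to a broadcast of `id`. -/
inductive NLabel (Id : Type u) (Label : Type v) : Type (max u v) where
  | tau : NLabel Id Label
  | send : Id → Id → Label → NLabel Id Label
  | recv : Id → Id → Label → NLabel Id Label
  | bsend : Id → Label → NLabel Id Label
  | brecv : Id → Label → NLabel Id Label

section NetLabels

variable {Id : Type u} {Label : Type v}

/-- The label is a broadcast label, enabling or reacting. -/
def NLabel.IsBroadcast : NLabel Id Label → Prop
  | .bsend _ _ => True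
  | .brecv _ _ => True
  | _ => False

/-- The label is `τ` or a broadcast output. -/
def NLabel.IsObservable : NLabel Id Label → Prop
  | .tau => True
  | .bsend _ _ => True
  | _ => False

/-- The graph of the (partial) synchronisation function on network labels. -/
inductive Gamma : NLabel Id Label → NLabel Id Label → NLabel Id Label → Prop
  | send_recv (id₁ id₂ f) : Gamma (.send id₁ id₂ f) (.recv id₂ id₁ f) .tau
  | recv_send (id₁ id₂ f) : Gamma (.recv id₁ id₂ f) (.send id₂ id₁ f) .tau
  | bsend_brecv (id f) : Gamma (.bsend id f) (.brecv id f) (.bsend id f)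
  | brecv_bsend (id f) : Gamma (.brecv id f) (.bsend id f) (.bsend id f)
  | brecv_brecv (id f) : Gamma (.brecv id f) (.brecv id f) (.brecv id f)

end NetLabels

section NetSemantics

variable {Id : Type u} {Label : Type v}

/-- A node in state `s` with behaviour `D` may discard the broadcast on `f` of node `id`: it is not
a child of `id`, or it has no reaction to the broadcast whose condition holds. -/
def Discard (M : Model.{u, v, w} Id Label) (s : State Id) (D : Defn Label M.Cond)
    (id : Id) (f : Label) : Prop :=
  ¬ (s.source = id ∧ ∃ c D', DStep M D (.inp c f .star) D' ∧ M.Sat s c)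

/-- The labelled transition system of networks. -/
inductive NStep (M : Model.{u, v, w} Id Label) :
    Network Id Label M.Cond → NLabel Id Label → Network Id Label M.Cond → Prop
  | loc {s D D' c f} : DStep M D (.loc c f) D' → M.Sat s c →
      NStep M (.node s D) .tau (.node s D')
  | oBinU {s D D' c f} : DStep M D (.out c f .up) D' → M.Sat s c →
      NStep M (.node s D) (.send s.self s.source f) (.node (M.effOut f .up s s.source) D')
  | oBinR {s D D' c f id} : DStep M D (.out c f .right) D' → M.Sat s c → id ∈ s.neighbours →
      NStep M (.node s D) (.send s.self id f) (.node (M.effOut f .right s id) D')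
  | iBin {s D D' c f d id} : d = .up ∨ d = .right → DStep M D (.inp c f d) D' → M.Sat s c →
      NStep M (.node s D) (.recv s.self id f) (.node (M.effIn f d s id) D')
  | oBrd {s D D' c f} : DStep M D (.out c f .star) D' → M.Sat s c →
      NStep M (.node s D) (.bsend s.self f) (.node s D')
  | iBrd {s D D' c f} : DStep M D (.inp c f .star) D' → M.Sat s c →
      NStep M (.node s D) (.brecv s.source f) (.node s D')
  | dBrd {s D id f} : Discard M s D id f →
      NStep M (.node s D) (.brecv id f) (.node s D)
  | com {N₁ N₂ N₁' N₂' l₁ l₂ l} : NStep M N₁ l₁ N₁' → NStep M N₂ l₂ N₂' → Gamma l₁ l₂ l →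
      NStep M (.par N₁ N₂) l (.par N₁' N₂')
  | par_left {N₁ N₂ N₁' l} : NStep M N₁ l N₁' → ¬ l.IsBroadcast →
      NStep M (.par N₁ N₂) l (.par N₁' N₂)
  | par_right {N₁ N₂ N₂' l} : NStep M N₂ l N₂' → ¬ l.IsBroadcast →
      NStep M (.par N₁ N₂) l (.par N₁ N₂')

/-- Structural congruence of definitions (and hence of reactions and choices). -/
inductive DCong {Cond : Type w} : Defn Label Cond → Defn Label Cond → Prop
  | refl (D) : DCong D D
  | symm {D E} : DCong D E → DCong E D
  | trans {D E F} : DCong D E → DCong E F → DCong D F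
  -- closure under the operators of the language
  | par_congr {D D' E E'} : DCong D D' → DCong E E' → DCong (.par D E) (.par D' E')
  | inp_congr (c f d) {R R' : Reaction Label Cond} : DCong R.toDefn R'.toDefn →
      DCong (.inp c f d R) (.inp c f d R')
  | plus_congr {A A' B B'} : DCong (.choice A) (.choice A') → DCong (.choice B) (.choice B') →
      DCong (.choice (.plus A B)) (.choice (.plus A' B'))
  -- axioms
  | par_nil (D) : DCong (.par D .nil) D
  | par_assoc (D E F) : DCong (.par D (.par E F)) (.par (.par D E) F)
  | par_comm (D E) : DCong (.par D E) (.par E D)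
  | inp_absorb (c f d R) : DCong (.par (.inp c f d R) (.inp c f d R)) (.inp c f d R)
  | plus_assoc (A B C) :
      DCong (.choice (.plus A (.plus B C))) (.choice (.plus (.plus A B) C))
  | plus_comm (A B) : DCong (.choice (.plus A B)) (.choice (.plus B A))

/-- Structural congruence of networks. -/
inductive NCong {Cond : Type w} : Network Id Label Cond → Network Id Label Cond → Prop
  | refl (N) : NCong N N
  | symm {N K} : NCong N K → NCong K N
  | trans {N K L} : NCong N K → NCong K L → NCong N L
  | par_congr {N N' K K'} : NCong N N' → NCong K K' → NCong (.par N K) (.par N' K')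
  | node (s) {D D'} : DCong D D' → NCong (.node s D) (.node s D')
  | par_assoc (N K L) : NCong (.par N (.par K L)) (.par (.par N K) L)
  | par_comm (N K) : NCong (.par N K) (.par K N)

end NetSemantics

/-! ### Projection -/

section Projection

variable {Id : Type u} {Label : Type v} {Cond : Type w}

/-- The enabling projection of a summation. -/
def Summ.outProj : Summ Id Label Cond → Choice Label Cond
  | .pre f d o _ _ => .out o f d
  | .plus S T => .plus S.outProj T.outProj

/-- The enabling projection. Instead of the body of the recursion that binds a variable, the mapping
`ρ` memorises the enabling projection of that body; the two agree when recursion is guarded, see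
`Proto.bind_zero`. -/
def Proto.outProj : Proto Id Label Cond → (ℕ → Reaction Label Cond) → Reaction Label Cond
  | .nil, _ => .nil
  | .par P Q, ρ => .par (P.outProj ρ) (Q.outProj ρ)
  | .mu P, ρ => P.outProj (scons (P.outProj (scons .nil ρ)) ρ)
  | .var n, ρ => ρ n
  | .sum S, _ => .choice S.outProj
  | .act _ P, ρ => P.outProj ρ

/-- The mapping extended by the association of a recursion variable to the recursion body `P`. The
occurrences of the variable in `P` are guarded and hence irrelevant to the projection of `P`. -/
def Proto.bind (P : Proto Id Label Cond) (ρ : ℕ → Reaction Label Cond) : ℕ → Reaction Label Cond :=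
  scons (P.outProj (scons .nil ρ)) ρ

/-- The enabling projection of a recursion is that of its body in the extended mapping. -/
theorem Proto.outProj_mu (P : Proto Id Label Cond) (ρ : ℕ → Reaction Label Cond) :
    (Proto.mu P).outProj ρ = P.outProj (P.bind ρ) := by
  rw [Proto.outProj, Proto.bind]

theorem Proto.outProj_congr : ∀ (P : Proto Id Label Cond) (n : ℕ) (ρ ρ' : ℕ → Reaction Label Cond),
    P.VarGuarded n → (∀ m, m ≠ n → ρ m = ρ' m) → P.outProj ρ = P.outProj ρ'
  | .nil, _, _, _, _, _ => by simp [Proto.outProj]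
  | .par P Q, n, ρ, ρ', h, e => by
      simp only [Proto.VarGuarded] at h
      rw [Proto.outProj, Proto.outProj, P.outProj_congr n ρ ρ' h.1 e, Q.outProj_congr n ρ ρ' h.2 e]
  | .mu P, n, ρ, ρ', h, e => by
      simp only [Proto.VarGuarded] at h
      have key : ∀ a, P.outProj (scons a ρ) = P.outProj (scons a ρ') := by
        intro a
        refine P.outProj_congr (n + 1) _ _ h ?_
        rintro (_ | m) hm
        · rfl
        · exact e m (by omega)
      rw [Proto.outProj, Proto.outProj, key, key]
  | .var m, n, ρ, ρ', h, e => by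
      simp only [Proto.VarGuarded] at h
      simpa [Proto.outProj] using e m h
  | .sum S, _, _, _, _, _ => by simp [Proto.outProj]
  | .act _ P, n, ρ, ρ', h, e => by
      simp only [Proto.VarGuarded] at h
      rw [Proto.outProj, Proto.outProj, P.outProj_congr n ρ ρ' h e]

/-- If recursion is guarded, the extended mapping assigns to the new variable the enabling projection
of the recursion body in that same extended mapping. -/
theorem Proto.bind_zero (P : Proto Id Label Cond) (ρ : ℕ → Reaction Label Cond)
    (h : P.VarGuarded 0) : (Proto.var 0 : Proto Id Label Cond).outProj (P.bind ρ) = P.outProj (P.bind ρ) := by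
  rw [Proto.outProj]
  refine P.outProj_congr 0 _ _ h ?_
  rintro (_ | m) hm
  · exact absurd rfl hm
  · rfl

mutual
  /-- The reactive projection. -/
  def Proto.inProj : Proto Id Label Cond → (ℕ → Reaction Label Cond) → Defn Label Cond
    | .nil, _ => .nil
    | .par P Q, ρ => .par (P.inProj ρ) (Q.inProj ρ)
    | .mu P, ρ => P.inProj (P.bind ρ)
    | .var _, _ => .nil
    | .sum S, ρ => S.inProj ρ
    | .act _ P, ρ => P.inProj ρ
  /-- The reactive projection. -/
  def Summ.inProj : Summ Id Label Cond → (ℕ → Reaction Label Cond) → Defn Label Cond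
    | .pre f d _ i P, ρ => .par (.inp i f d (P.outProj ρ)) (P.inProj ρ)
    | .plus S T, ρ => .par (S.inProj ρ) (T.inProj ρ)
end

variable [DecidableEq Id]

mutual
  /-- The active projection for the node `id`. -/
  def Proto.actProj (id : Id) :
      Proto Id Label Cond → (ℕ → Reaction Label Cond) → Reaction Label Cond
    | .nil, _ => .nil
    | .par P Q, ρ => .par (P.actProj id ρ) (Q.actProj id ρ)
    | .mu P, ρ => P.actProj id (P.bind ρ)
    | .var _, _ => .nil
    | .sum S, ρ => S.actProj id ρ
    | .act id' P, ρ => if id' = id then .par (P.actProj id ρ) (P.outProj ρ) else P.actProj id ρ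
  /-- The active projection for the node `id`. -/
  def Summ.actProj (id : Id) :
      Summ Id Label Cond → (ℕ → Reaction Label Cond) → Reaction Label Cond
    | .pre _ _ _ _ P, ρ => P.actProj id ρ
    | .plus S T, ρ => .par (S.actProj id ρ) (T.actProj id ρ)
end

/-- The behaviour of the node `id`: the reactive and the active projection, in the empty mapping. -/
def Proto.nodeProj (P : Proto Id Label Cond) (id : Id) : Defn Label Cond :=
  .par (P.inProj fun _ => .nil) (P.actProj id fun _ => .nil).toDefn

/-- The projection of a configuration: the parallel composition of all its nodes (in some order). -/
noncomputable def netProj (Δ : NetState Id) (P : Proto Id Label Cond) : Network Id Label Cond :=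
  Network.ofList (Δ.map.entries.toList.map fun e => .node e.2 (P.nodeProj e.1))
    (fun h => Δ.nonempty (List.map_eq_nil_iff.mp h))

end Projection

end OpControl

-- A reduction contracts one redex `[o]f^d[i].P` on which some node `id` is active. In the network
-- the same event is an output on `f` from the active projection of `id`, answered by inputs on `f`
-- of the reacting nodes. Three things have to be controlled to make the two views move in step.
--
-- Congruence. Behaviours matter only up to `DCong`. Modulo `DCong` they form a commutative monoid
-- in which inputs are idempotent, and `DCong` is a strong bisimulation (`DCong.simulates`). The
-- projections must be invariant under `SCong`, and the critical axiom is unfolding, which may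
-- duplicate the body of a recursion. The reactive projection tolerates this because it depends only
-- on the set of actions, listed by `Proto.occs` (`Proto.inProj_cls_eq`). The enabling projection
-- tolerates it because recursion is guarded. The active projection would count active nodes of a
-- duplicated body twice, so a further invariant is needed. Absence of `(id)` below recursions is
-- not stable under `SCong`, since `(id)0 ≡ 0` and vacuous recursions can be introduced anywhere.
-- The stable version is `Proto.Regular`: it restricts only recursions whose variable occurs, and it
-- allows activity on void protocols, which project to zero.
--
-- Labels. Unfolding also destroys distinctness of labels. What survives is `Proto.Coherent`: two
-- actions with the same label agree in direction, conditions and class of continuation. It is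
-- preserved because neither congruence nor reduction changes the set of actions.
--
-- Steps. A reduction splits into a purely syntactic contraction (`ActStep`, with a list `I` of
-- nodes that become active on the continuation) and a condition on states (`Enabled`). Soundness
-- rests on `ActStep.effect`: a contraction is matched by an output of `id`, and `Effect` computes
-- all projections afterwards. Completeness rests on the converse `exists_actStep_of_actProj`: every
-- output of an active projection comes from a redex. Coherence then ensures that the inputs
-- answering the output belong to the same action as the redex. Transitions of the whole network are
-- reduced to transitions of its nodes by `ListStep`.

namespace OpControl

/-! ### Definitions up to structural congruence form a commutative monoid -/

section Classes

variable {Label : Type v} {Cond : Type w}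

/-- Structural congruence of definitions as a setoid. -/
def Defn.setoid (Label : Type v) (Cond : Type w) : Setoid (Defn Label Cond) :=
  ⟨DCong, ⟨.refl, .symm, .trans⟩⟩

/-- Definitions up to structural congruence. -/
def DClass (Label : Type v) (Cond : Type w) : Type (max v w) := Quotient (Defn.setoid Label Cond)

/-- The congruence class of a definition. -/
def Defn.cls (D : Defn Label Cond) : DClass Label Cond := Quotient.mk (Defn.setoid Label Cond) D

theorem Defn.cls_eq {D E : Defn Label Cond} : D.cls = E.cls ↔ DCong D E :=
  ⟨fun h => Quotient.exact (s := Defn.setoid Label Cond) h,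
    fun h => Quotient.sound (s := Defn.setoid Label Cond) h⟩

theorem DClass.ind {p : DClass Label Cond → Prop} (h : ∀ D : Defn Label Cond, p D.cls) (a) : p a :=
  Quotient.inductionOn a h

instance : Add (DClass Label Cond) :=
  ⟨Quotient.map₂ Defn.par fun _ _ h _ _ h' => .par_congr h h'⟩

instance : Zero (DClass Label Cond) := ⟨Defn.nil.cls⟩

/-- Lets `simp` and `abel` carry out the rearrangements of parallel compositions. -/
instance : AddCommMonoid (DClass Label Cond) where
  add_assoc := by
    intro a b c
    induction a using DClass.ind
    induction b using DClass.ind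
    induction c using DClass.ind
    exact Defn.cls_eq.2 (.symm (.par_assoc _ _ _))
  add_comm := by
    intro a b
    induction a using DClass.ind
    induction b using DClass.ind
    exact Defn.cls_eq.2 (.par_comm _ _)
  zero_add := by
    intro a
    induction a using DClass.ind
    exact Defn.cls_eq.2 (.trans (.par_comm _ _) (.par_nil _))
  add_zero := by
    intro a
    induction a using DClass.ind
    exact Defn.cls_eq.2 (.par_nil _)
  nsmul := nsmulRec

@[simp] theorem Defn.cls_par (D E : Defn Label Cond) : (Defn.par D E).cls = D.cls + E.cls := rfl

@[simp] theorem Defn.cls_nil : (Defn.nil : Defn Label Cond).cls = 0 := rfl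

theorem Defn.cls_inp_absorb (c : Cond) (f : Label) (d : Dir) (R : Reaction Label Cond) :
    (Defn.inp c f d R).cls + (Defn.inp c f d R).cls = (Defn.inp c f d R).cls :=
  Defn.cls_eq.2 (.inp_absorb _ _ _ _)

/-- The congruence class of a reaction. -/
def Reaction.cls (R : Reaction Label Cond) : DClass Label Cond := R.toDefn.cls

@[simp] theorem Reaction.cls_toDefn (R : Reaction Label Cond) : R.toDefn.cls = R.cls := rfl

@[simp] theorem Reaction.cls_par (R R' : Reaction Label Cond) :
    (Reaction.par R R').cls = R.cls + R'.cls := rfl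

@[simp] theorem Reaction.cls_nil : (Reaction.nil : Reaction Label Cond).cls = 0 := rfl

theorem Reaction.cls_plus_congr {A A' B B' : Choice Label Cond}
    (hA : (Reaction.choice A).cls = (Reaction.choice A').cls)
    (hB : (Reaction.choice B).cls = (Reaction.choice B').cls) :
    (Reaction.choice (A.plus B)).cls = (Reaction.choice (A'.plus B')).cls :=
  Defn.cls_eq.2 (.plus_congr (Defn.cls_eq.1 hA) (Defn.cls_eq.1 hB))

theorem Defn.cls_inp_congr (c : Cond) (f : Label) (d : Dir) {R R' : Reaction Label Cond}
    (h : R.cls = R'.cls) : (Defn.inp c f d R).cls = (Defn.inp c f d R').cls :=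
  Defn.cls_eq.2 (.inp_congr _ _ _ (Defn.cls_eq.1 h))

end Classes

-- Structural congruence of definitions is a strong bisimulation.

section Bisimulation

variable {Id : Type u} {Label : Type v} (M : Model.{u, v, w} Id Label)

theorem DStep.choice_plus_iff {A B : Choice Label M.Cond} {α D} :
    DStep M (.choice (.plus A B)) α D ↔ DStep M (.choice A) α D ∨ DStep M (.choice B) α D := by
  constructor
  · intro h
    cases h with
    | sum_left h => exact .inl h
    | sum_right h => exact .inr h
  · rintro (h | h)
    · exact .sum_left h
    · exact .sum_right h

/-- Every step of `D` is matched by `E`, up to structural congruence. -/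
def Simulates (D E : Defn Label M.Cond) : Prop :=
  ∀ α D', DStep M D α D' → ∃ E', DStep M E α E' ∧ D'.cls = E'.cls

theorem Simulates.par_comm (D E : Defn Label M.Cond) : Simulates M (.par D E) (.par E D) := by
  intro α F h
  cases h with
  | int_left h => exact ⟨_, .int_right h, by simp [add_comm]⟩
  | int_right h => exact ⟨_, .int_left h, by simp [add_comm]⟩
  | self_left h h' => exact ⟨_, .self_right h' h, by simp [add_comm]⟩
  | self_right h h' => exact ⟨_, .self_left h' h, by simp [add_comm]⟩

theorem Simulates.par_congr {D D' E E' : Defn Label M.Cond} (hD : Simulates M D D')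
    (hE : Simulates M E E') (h₁ : D.cls = D'.cls) (h₂ : E.cls = E'.cls) :
    Simulates M (.par D E) (.par D' E') := by
  intro α F h
  cases h with
  | int_left h =>
    obtain ⟨G, hG, e⟩ := hD _ _ h
    exact ⟨_, .int_left hG, by simp [e, h₂]⟩
  | int_right h =>
    obtain ⟨G, hG, e⟩ := hE _ _ h
    exact ⟨_, .int_right hG, by simp [e, h₁]⟩
  | self_left h h' =>
    obtain ⟨G, hG, e⟩ := hD _ _ h
    obtain ⟨G', hG', e'⟩ := hE _ _ h'
    exact ⟨_, .self_left hG hG', by simp [e, e']⟩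
  | self_right h h' =>
    obtain ⟨G, hG, e⟩ := hD _ _ h
    obtain ⟨G', hG', e'⟩ := hE _ _ h'
    exact ⟨_, .self_right hG hG', by simp [e, e']⟩

theorem Simulates.par_assoc (D E F : Defn Label M.Cond) :
    Simulates M (.par D (.par E F)) (.par (.par D E) F) := by
  intro α G h
  cases h with
  | int_left h => exact ⟨_, .int_left (.int_left h), by simp [add_assoc]⟩
  | int_right h =>
    cases h with
    | int_left h => exact ⟨_, .int_left (.int_right h), by simp [add_assoc]⟩
    | int_right h => exact ⟨_, .int_right h, by simp [add_assoc]⟩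
    | self_left h h' => exact ⟨_, .self_left (.int_right h) h', by simp [add_assoc]⟩
    | self_right h h' => exact ⟨_, .self_right (.int_right h) h', by simp [add_assoc]⟩
  | self_left h h' =>
    cases h' with
    | int_left h' => exact ⟨_, .int_left (.self_left h h'), by simp [add_assoc]⟩
    | int_right h' => exact ⟨_, .self_left (.int_left h) h', by simp [add_assoc]⟩
  | self_right h h' =>
    cases h' with
    | int_left h' => exact ⟨_, .int_left (.self_right h h'), by simp [add_assoc]⟩
    | int_right h' => exact ⟨_, .self_right (.int_left h) h', by simp [add_assoc]⟩

theorem Simulates.par_assoc_symm (D E F : Defn Label M.Cond) :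
    Simulates M (.par (.par D E) F) (.par D (.par E F)) := by
  intro α G h
  cases h with
  | int_right h => exact ⟨_, .int_right (.int_right h), by simp [add_assoc]⟩
  | int_left h =>
    cases h with
    | int_left h => exact ⟨_, .int_left h, by simp [add_assoc]⟩
    | int_right h => exact ⟨_, .int_right (.int_left h), by simp [add_assoc]⟩
    | self_left h h' => exact ⟨_, .self_left h (.int_left h'), by simp [add_assoc]⟩
    | self_right h h' => exact ⟨_, .self_right h (.int_left h'), by simp [add_assoc]⟩
  | self_left h h' =>
    cases h with
    | int_left h => exact ⟨_, .self_left h (.int_right h'), by simp [add_assoc]⟩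
    | int_right h => exact ⟨_, .int_right (.self_left h h'), by simp [add_assoc]⟩
  | self_right h h' =>
    cases h with
    | int_left h => exact ⟨_, .self_right h (.int_right h'), by simp [add_assoc]⟩
    | int_right h => exact ⟨_, .int_right (.self_right h h'), by simp [add_assoc]⟩

theorem Simulates.inp_congr (c : M.Cond) (f : Label) (d : Dir) {R R' : Reaction Label M.Cond}
    (e : R.cls = R'.cls) : Simulates M (.inp c f d R) (.inp c f d R') := by
  intro α D h
  cases h
  exact ⟨_, .inp _ _ _ _, by simp [e, Defn.cls_inp_congr c f d e]⟩

/-- Both directions are proved together because the induction runs through `symm`. Each axiom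
permutes or merges components, and the residuals differ only by the same axiom. -/
theorem DCong.simulates {D E : Defn Label M.Cond} (h : DCong D E) :
    Simulates M D E ∧ Simulates M E D := by
  induction h with
  | refl D => exact ⟨fun _ _ h => ⟨_, h, rfl⟩, fun _ _ h => ⟨_, h, rfl⟩⟩
  | symm _ ih => exact ih.symm
  | trans _ _ ih ih' =>
    constructor
    · intro α D' h
      obtain ⟨E', h, e⟩ := ih.1 _ _ h
      obtain ⟨F', h, e'⟩ := ih'.1 _ _ h
      exact ⟨_, h, e.trans e'⟩
    · intro α D' h
      obtain ⟨E', h, e⟩ := ih'.2 _ _ h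
      obtain ⟨F', h, e'⟩ := ih.2 _ _ h
      exact ⟨_, h, e.trans e'⟩
  | par_congr h h' ih ih' =>
    have e := Defn.cls_eq.2 h
    have e' := Defn.cls_eq.2 h'
    exact ⟨.par_congr M ih.1 ih'.1 e e', .par_congr M ih.2 ih'.2 e.symm e'.symm⟩
  | inp_congr c f d h _ =>
    have e : Reaction.cls _ = Reaction.cls _ := Defn.cls_eq.2 h
    exact ⟨.inp_congr M c f d e, .inp_congr M c f d e.symm⟩
  | plus_congr _ _ ih ih' =>
    constructor
    · intro α D' h
      rw [DStep.choice_plus_iff] at h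
      simp only [DStep.choice_plus_iff]
      rcases h with h | h
      · obtain ⟨E', h, e⟩ := ih.1 _ _ h
        exact ⟨E', .inl h, e⟩
      · obtain ⟨E', h, e⟩ := ih'.1 _ _ h
        exact ⟨E', .inr h, e⟩
    · intro α D' h
      rw [DStep.choice_plus_iff] at h
      simp only [DStep.choice_plus_iff]
      rcases h with h | h
      · obtain ⟨E', h, e⟩ := ih.2 _ _ h
        exact ⟨E', .inl h, e⟩
      · obtain ⟨E', h, e⟩ := ih'.2 _ _ h
        exact ⟨E', .inr h, e⟩
  | par_nil D =>
    constructor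
    · intro α D' h
      cases h with
      | int_left h => exact ⟨_, h, by simp⟩
      | int_right h => cases h
      | self_left _ h => cases h
      | self_right _ h => cases h
    · intro α D' h
      exact ⟨_, .int_left h, by simp⟩
  | par_assoc D E F => exact ⟨.par_assoc M D E F, .par_assoc_symm M D E F⟩
  | par_comm D E => exact ⟨.par_comm M D E, .par_comm M E D⟩
  -- An input persists after it fires. Whichever copy fires, both copies are still there, next to
  -- one new continuation, and they merge again.
  | inp_absorb c f d R =>
    constructor
    · intro α D' h
      cases h with
      | int_left h =>
        cases h
        exact ⟨_, .inp _ _ _ _, by simp [add_assoc, Defn.cls_inp_absorb]⟩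
      | int_right h =>
        cases h
        refine ⟨_, .inp _ _ _ _, ?_⟩
        simp only [Defn.cls_par]
        rw [add_left_comm, Defn.cls_inp_absorb]
      | self_left h => cases h
      | self_right _ h => cases h
    · intro α D' h
      cases h
      exact ⟨_, .int_left (.inp _ _ _ _), by simp [add_assoc, Defn.cls_inp_absorb]⟩
  | plus_assoc A B C =>
    constructor <;> intro α D' h <;> refine ⟨D', ?_, rfl⟩ <;>
      simp only [DStep.choice_plus_iff] at h ⊢ <;> tauto
  | plus_comm A B =>
    constructor <;> intro α D' h <;> refine ⟨D', ?_, rfl⟩ <;>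
      simp only [DStep.choice_plus_iff] at h ⊢ <;> tauto

/-- Congruent definitions have the same steps up to structural congruence. -/
theorem DStep.of_cls_eq {D E D' : Defn Label M.Cond} {α} (h : DStep M D α D') (e : D.cls = E.cls) :
    ∃ E', DStep M E α E' ∧ D'.cls = E'.cls :=
  (DCong.simulates M (Defn.cls_eq.1 e)).1 _ _ h

end Bisimulation

/-! ### Syntactic properties that structural congruence preserves -/

section SyntacticProperties

variable {Id : Type u} {Label : Type v} {Cond : Type w}

-- One predicate suffices for the mutual recursion: on a summation `S` it is read as `p (.sum S)`,
-- which fits the rules of `SCong` for `pre` and `plus`.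
mutual
  theorem Proto.induct_aux {p : Proto Id Label Cond → Prop} (nil : p .nil)
      (par : ∀ P Q, p P → p Q → p (.par P Q)) (mu : ∀ P, p P → p (.mu P)) (var : ∀ n, p (.var n))
      (act : ∀ id P, p P → p (.act id P))
      (pre : ∀ f d o i P, p P → p (.sum (.pre f d o i P)))
      (plus : ∀ S T, p (.sum S) → p (.sum T) → p (.sum (.plus S T))) : ∀ P, p P
    | .nil => nil
    | .par P Q => par P Q (P.induct_aux nil par mu var act pre plus)
        (Q.induct_aux nil par mu var act pre plus)
    | .mu P => mu P (P.induct_aux nil par mu var act pre plus)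
    | .var n => var n
    | .sum S => S.induct_aux nil par mu var act pre plus
    | .act id P => act id P (P.induct_aux nil par mu var act pre plus)
  theorem Summ.induct_aux {p : Proto Id Label Cond → Prop} (nil : p .nil)
      (par : ∀ P Q, p P → p Q → p (.par P Q)) (mu : ∀ P, p P → p (.mu P)) (var : ∀ n, p (.var n))
      (act : ∀ id P, p P → p (.act id P))
      (pre : ∀ f d o i P, p P → p (.sum (.pre f d o i P)))
      (plus : ∀ S T, p (.sum S) → p (.sum T) → p (.sum (.plus S T))) : ∀ S, p (.sum S)
    | .pre f d o i P => pre f d o i P (P.induct_aux nil par mu var act pre plus)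
    | .plus S T => plus S T (S.induct_aux nil par mu var act pre plus)
        (T.induct_aux nil par mu var act pre plus)
end

/-- Induction on protocols in which summations are protocols. -/
@[elab_as_elim]
theorem Proto.induct {p : Proto Id Label Cond → Prop} (P : Proto Id Label Cond) (nil : p .nil)
    (par : ∀ P Q, p P → p Q → p (.par P Q)) (mu : ∀ P, p P → p (.mu P)) (var : ∀ n, p (.var n))
    (act : ∀ id P, p P → p (.act id P))
    (pre : ∀ f d o i P, p P → p (.sum (.pre f d o i P)))
    (plus : ∀ S T, p (.sum S) → p (.sum T) → p (.sum (.plus S T))) : p P :=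
  P.induct_aux nil par mu var act pre plus

mutual
  /-- The variable `n` occurs freely. -/
  def Proto.Free (n : ℕ) : Proto Id Label Cond → Prop
    | .nil => False
    | .par P Q => P.Free n ∨ Q.Free n
    | .mu P => P.Free (n + 1)
    | .var m => m = n
    | .sum S => S.Free n
    | .act _ P => P.Free n
  /-- The variable `n` occurs freely. -/
  def Summ.Free (n : ℕ) : Summ Id Label Cond → Prop
    | .pre _ _ _ _ P => P.Free n
    | .plus S T => S.Free n ∨ T.Free n
end

/-- There are neither synchronisation actions nor recursion variables. -/
def Proto.Void : Proto Id Label Cond → Prop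
  | .nil => True
  | .par P Q => P.Void ∧ Q.Void
  | .mu P => P.Void
  | .var _ => False
  | .sum _ => False
  | .act _ P => P.Void

mutual
  /-- Nodes are active on void protocols only. -/
  def Proto.VoidActs : Proto Id Label Cond → Prop
    | .nil => True
    | .par P Q => P.VoidActs ∧ Q.VoidActs
    | .mu P => P.VoidActs
    | .var _ => True
    | .sum S => S.VoidActs
    | .act _ P => P.Void
  /-- Nodes are active on void protocols only. -/
  def Summ.VoidActs : Summ Id Label Cond → Prop
    | .pre _ _ _ _ P => P.VoidActs
    | .plus S T => S.VoidActs ∧ T.VoidActs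
end

mutual
  /-- Inside recursions whose variable occurs, nodes are active on void protocols only. -/
  def Proto.Regular : Proto Id Label Cond → Prop
    | .nil => True
    | .par P Q => P.Regular ∧ Q.Regular
    | .mu P => P.Regular ∧ (P.Free 0 → P.VoidActs)
    | .var _ => True
    | .sum S => S.Regular
    | .act _ P => P.Regular
  /-- Inside recursions whose variable occurs, nodes are active on void protocols only. -/
  def Summ.Regular : Summ Id Label Cond → Prop
    | .pre _ _ _ _ P => P.Regular
    | .plus S T => S.Regular ∧ T.Regular
end

/-- The substitution that acts below a binder like `τ` outside. -/
def Proto.lift (τ : ℕ → Proto Id Label Cond) : ℕ → Proto Id Label Cond :=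
  scons (.var 0) fun n => (τ n).rename Nat.succ

@[simp] theorem scons_zero {α : Type*} (a : α) (ρ : ℕ → α) : scons a ρ 0 = a := rfl

@[simp] theorem scons_succ {α : Type*} (a : α) (ρ : ℕ → α) (n : ℕ) : scons a ρ (n + 1) = ρ n := rfl

@[simp] theorem Proto.lift_zero (τ : ℕ → Proto Id Label Cond) : Proto.lift τ 0 = .var 0 := rfl

@[simp] theorem Proto.lift_succ (τ : ℕ → Proto Id Label Cond) (n : ℕ) :
    Proto.lift τ (n + 1) = (τ n).rename Nat.succ := rfl

attribute [simp] Proto.rename Summ.rename Summ.subst Proto.Free Summ.Free Proto.Void Proto.VoidActs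
  Summ.VoidActs Proto.Regular Summ.Regular Proto.VarGuarded Proto.Guarded Summ.Guarded

@[simp] theorem Proto.subst_nil (τ : ℕ → Proto Id Label Cond) : Proto.nil.subst τ = .nil := by
  rw [Proto.subst]

@[simp] theorem Proto.subst_par (τ : ℕ → Proto Id Label Cond) (P Q) :
    (Proto.par P Q).subst τ = .par (P.subst τ) (Q.subst τ) := by
  rw [Proto.subst]

-- Phrased with `Proto.lift`, so that facts about substitution under a binder have a name to attach
-- to.
@[simp] theorem Proto.subst_mu (τ : ℕ → Proto Id Label Cond) (P) :
    (Proto.mu P).subst τ = .mu (P.subst (Proto.lift τ)) := by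
  rw [Proto.subst, Proto.lift]

@[simp] theorem Proto.subst_var (τ : ℕ → Proto Id Label Cond) (n) :
    (Proto.var n).subst τ = τ n := by
  rw [Proto.subst]

@[simp] theorem Proto.subst_sum (τ : ℕ → Proto Id Label Cond) (S) :
    (Proto.sum S).subst τ = .sum (S.subst τ) := by
  rw [Proto.subst]

@[simp] theorem Proto.subst_act (τ : ℕ → Proto Id Label Cond) (id P) :
    (Proto.act id P).subst τ = .act id (P.subst τ) := by
  rw [Proto.subst]

theorem exists_nat_iff {p : ℕ → Prop} : (∃ n, p n) ↔ p 0 ∨ ∃ n, p (n + 1) := by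
  constructor
  · rintro ⟨_ | n, h⟩
    · exact .inl h
    · exact .inr ⟨n, h⟩
  · rintro (h | ⟨n, h⟩)
    · exact ⟨0, h⟩
    · exact ⟨n + 1, h⟩

theorem forall_nat_iff {p : ℕ → Prop} : (∀ n, p n) ↔ p 0 ∧ ∀ n, p (n + 1) :=
  ⟨fun h => ⟨h 0, fun n => h (n + 1)⟩, fun h n => by cases n; exacts [h.1, h.2 _]⟩

theorem Proto.free_rename (P : Proto Id Label Cond) : ∀ (m : ℕ) (ξ : ℕ → ℕ),
    (P.rename ξ).Free m ↔ ∃ n, P.Free n ∧ ξ n = m := by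
  induction P using Proto.induct with
  | nil => simp
  | par P Q hP hQ => intro m ξ; simp [hP, hQ, or_and_right, exists_or]
  | mu P hP => intro m ξ; simp [hP, exists_nat_iff (p := fun n => P.Free n ∧ _)]
  | var n => intro m ξ; simp
  | act id P hP => intro m ξ; simp [hP]
  | pre f d o i P hP => intro m ξ; simp [hP]
  | plus S T hS hT =>
    intro m ξ
    simp only [Proto.rename, Proto.Free] at hS hT
    simp [hS, hT, or_and_right, exists_or]

theorem Proto.free_subst (P : Proto Id Label Cond) : ∀ (m : ℕ) (τ : ℕ → Proto Id Label Cond),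
    (P.subst τ).Free m ↔ ∃ n, P.Free n ∧ (τ n).Free m := by
  induction P using Proto.induct with
  | nil => simp
  | par P Q hP hQ => intro m τ; simp [hP, hQ, or_and_right, exists_or]
  | mu P hP =>
    intro m τ
    simp [hP, exists_nat_iff (p := fun n => P.Free n ∧ _), Proto.free_rename]
  | var n => intro m τ; simp
  | act id P hP => intro m τ; simp [hP]
  | pre f d o i P hP => intro m τ; simp [hP]
  | plus S T hS hT =>
    intro m τ
    simp only [Proto.subst_sum, Proto.Free] at hS hT
    simp [hS, hT, or_and_right, exists_or]

theorem Proto.free_unfold (P : Proto Id Label Cond) (m : ℕ) :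
    P.unfold.Free m ↔ (Proto.mu P).Free m := by
  rw [Proto.unfold, Proto.free_subst, exists_nat_iff]
  simp

theorem SCong.free_iff {P Q : Proto Id Label Cond} (h : SCong P Q) (m : ℕ) :
    P.Free m ↔ Q.Free m := by
  induction h generalizing m with
  | refl => rfl
  | symm _ ih => exact (ih m).symm
  | trans _ _ ih ih' => exact (ih m).trans (ih' m)
  | par_congr _ _ ih ih' => simp [ih, ih']
  | mu_congr _ ih => simp [ih]
  | act_congr id _ ih => simp [ih]
  | pre_congr f d o i _ ih => simp [ih]
  | plus_congr _ _ ih ih' =>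
    simp only [Proto.Free] at ih ih'
    simp [ih, ih']
  | mu_unfold P => exact (P.free_unfold m).symm
  | _ => simp [or_comm, or_assoc]

theorem Proto.free_zero_subst_lift (P : Proto Id Label Cond) (τ : ℕ → Proto Id Label Cond) :
    (P.subst (Proto.lift τ)).Free 0 ↔ P.Free 0 := by
  rw [Proto.free_subst, exists_nat_iff]
  simp [Proto.free_rename]

theorem Proto.free_zero_rename_lift (P : Proto Id Label Cond) (ξ : ℕ → ℕ) :
    (P.rename (scons 0 fun n => ξ n + 1)).Free 0 ↔ P.Free 0 := by
  rw [Proto.free_rename, exists_nat_iff]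
  simp

/-- Below a binder, a substitution that is a renaming on the free variables remains one. -/
theorem Proto.lift_isVar {P : Proto Id Label Cond} {τ : ℕ → Proto Id Label Cond}
    (h : ∀ n, (Proto.mu P).Free n → ∃ m, τ n = .var m) :
    ∀ n, P.Free n → ∃ m, Proto.lift τ n = .var m := by
  rintro (_ | n) hn
  · exact ⟨0, rfl⟩
  · obtain ⟨m, e⟩ := h n hn
    exact ⟨m + 1, by simp [e]⟩

theorem Proto.unfold_isVar {P : Proto Id Label Cond} (h : ¬ P.Free 0) :
    ∀ n, P.Free n → ∃ m, (scons (.mu P) .var : ℕ → Proto Id Label Cond) n = .var m := by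
  rintro (_ | n) hn
  · exact absurd hn h
  · exact ⟨n, rfl⟩

/-! #### Void protocols -/

theorem Proto.void_rename (P : Proto Id Label Cond) : ∀ ξ : ℕ → ℕ, (P.rename ξ).Void ↔ P.Void := by
  induction P using Proto.induct <;> simp_all

theorem Proto.Void.of_subst {P : Proto Id Label Cond} : ∀ {τ : ℕ → Proto Id Label Cond} {n : ℕ},
    (P.subst τ).Void → P.Free n → (τ n).Void := by
  induction P using Proto.induct with
  | mu P hP =>
    intro τ n h hn
    simpa [Proto.void_rename] using hP (n := n + 1) h hn
  | par P Q hP hQ =>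
    rintro τ n h (hn | hn)
    · exact hP h.1 hn
    · exact hQ h.2 hn
  | _ => simp_all

theorem Proto.Void.subst {P : Proto Id Label Cond} : ∀ (τ : ℕ → Proto Id Label Cond),
    P.Void → (P.subst τ).Void := by
  induction P using Proto.induct <;> simp_all

theorem Proto.void_subst_of_isVar {P : Proto Id Label Cond} : ∀ {τ : ℕ → Proto Id Label Cond},
    (∀ n, P.Free n → ∃ m, τ n = .var m) → ((P.subst τ).Void ↔ P.Void) := by
  induction P using Proto.induct with
  | mu P hP => intro τ h; exact hP (Proto.lift_isVar h)
  | par P Q hP hQ =>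
    intro τ h
    simp [hP fun n hn => h n (.inl hn), hQ fun n hn => h n (.inr hn)]
  | var n =>
    intro τ h
    obtain ⟨m, e⟩ := h n rfl
    simp [e]
  | act id P hP => intro τ h; exact hP h
  | _ => simp

/-- If the variable occurs, the unfolding contains a copy of `mu P`, from which the property can be
read off. If it does not, unfolding only renames variables. The same dichotomy recurs for
`VoidActs`, `Regular` and the active projection. -/
theorem Proto.void_unfold (P : Proto Id Label Cond) : P.unfold.Void ↔ P.Void := by
  by_cases h0 : P.Free 0
  · exact ⟨fun h => Proto.Void.of_subst (n := 0) h h0, fun h => h.subst _⟩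
  · exact Proto.void_subst_of_isVar (Proto.unfold_isVar h0)

theorem SCong.void_iff {P Q : Proto Id Label Cond} (h : SCong P Q) : P.Void ↔ Q.Void := by
  induction h with
  | refl => rfl
  | symm _ ih => exact ih.symm
  | trans _ _ ih ih' => exact ih.trans ih'
  | mu_unfold P => exact P.void_unfold.symm
  | _ => simp_all [and_comm, and_assoc]

/-! #### Protocols in which nodes are active on void protocols only -/

theorem Proto.voidActs_rename (P : Proto Id Label Cond) :
    ∀ ξ : ℕ → ℕ, (P.rename ξ).VoidActs ↔ P.VoidActs := by
  induction P using Proto.induct <;> simp_all [Proto.void_rename]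

theorem Proto.Void.voidActs {P : Proto Id Label Cond} (h : P.Void) : P.VoidActs := by
  induction P using Proto.induct <;> simp_all

theorem Proto.VoidActs.of_subst {P : Proto Id Label Cond} :
    ∀ {τ : ℕ → Proto Id Label Cond} {n : ℕ}, (P.subst τ).VoidActs → P.Free n → (τ n).VoidActs := by
  induction P using Proto.induct with
  | nil => simp
  | mu P hP =>
    intro τ n h hn
    simpa [Proto.voidActs_rename] using hP (n := n + 1) h hn
  | par P Q hP hQ =>
    rintro τ n h (hn | hn)
    · exact hP h.1 hn
    · exact hQ h.2 hn
  | plus S T hS hT =>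
    rintro τ n h (hn | hn)
    · exact hS h.1 hn
    · exact hT h.2 hn
  | var n => rintro τ m h rfl; exact h
  | act id P => intro τ n h hn; exact (Proto.Void.of_subst h hn).voidActs
  | pre f d o i P hP => intro τ n h hn; exact hP h hn

theorem Proto.VoidActs.subst {P : Proto Id Label Cond} : ∀ {τ : ℕ → Proto Id Label Cond},
    P.VoidActs → (∀ n, P.Free n → (τ n).VoidActs) → (P.subst τ).VoidActs := by
  induction P using Proto.induct with
  | nil => simp
  | mu P hP =>
    intro τ h hτ
    refine hP h ?_
    rintro (_ | n) hn
    · simp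
    · simpa [Proto.voidActs_rename] using hτ n hn
  | par P Q hP hQ =>
    intro τ h hτ
    exact ⟨hP h.1 fun n hn => hτ n (.inl hn), hQ h.2 fun n hn => hτ n (.inr hn)⟩
  | plus S T hS hT =>
    intro τ h hτ
    exact ⟨hS h.1 fun n hn => hτ n (.inl hn), hT h.2 fun n hn => hτ n (.inr hn)⟩
  | var n => intro τ h hτ; exact hτ n rfl
  | act id P => intro τ h hτ; exact Proto.Void.subst τ h
  | pre f d o i P hP => intro τ h hτ; exact hP h hτ

theorem Proto.voidActs_subst_of_isVar {P : Proto Id Label Cond} :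
    ∀ {τ : ℕ → Proto Id Label Cond}, (∀ n, P.Free n → ∃ m, τ n = .var m) →
      ((P.subst τ).VoidActs ↔ P.VoidActs) := by
  induction P using Proto.induct with
  | nil => simp
  | mu P hP => intro τ h; exact hP (Proto.lift_isVar h)
  | par P Q hP hQ =>
    intro τ h
    exact and_congr (hP fun n hn => h n (.inl hn)) (hQ fun n hn => h n (.inr hn))
  | plus S T hS hT =>
    intro τ h
    exact and_congr (hS fun n hn => h n (.inl hn)) (hT fun n hn => h n (.inr hn))
  | var n =>
    intro τ h
    obtain ⟨m, e⟩ := h n rfl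
    simp [e]
  | act id P => intro τ h; exact Proto.void_subst_of_isVar h
  | pre f d o i P hP => intro τ h; exact hP h

theorem Proto.voidActs_unfold (P : Proto Id Label Cond) : P.unfold.VoidActs ↔ P.VoidActs := by
  by_cases h0 : P.Free 0
  · refine ⟨fun h => Proto.VoidActs.of_subst (n := 0) h h0, fun h => h.subst ?_⟩
    -- Index `0` is replaced by `mu P`, every other index by a variable.
    rintro (_ | n) -
    · exact h
    · simp
  · exact Proto.voidActs_subst_of_isVar (Proto.unfold_isVar h0)

theorem SCong.voidActs_iff {P Q : Proto Id Label Cond} (h : SCong P Q) :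
    P.VoidActs ↔ Q.VoidActs := by
  induction h with
  | refl => rfl
  | symm _ ih => exact ih.symm
  | trans _ _ ih ih' => exact ih.trans ih'
  | mu_unfold P => exact P.voidActs_unfold.symm
  | act_congr id h => exact h.void_iff
  | _ => simp_all [and_comm, and_assoc]

/-! #### Regular protocols -/

theorem Proto.regular_rename (P : Proto Id Label Cond) :
    ∀ ξ : ℕ → ℕ, (P.rename ξ).Regular ↔ P.Regular := by
  induction P using Proto.induct <;>
    simp_all [Proto.voidActs_rename, Proto.free_zero_rename_lift]

theorem Proto.VoidActs.regular {P : Proto Id Label Cond} (h : P.VoidActs) : P.Regular := by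
  induction P using Proto.induct with
  | act id P hP => exact hP (Proto.Void.voidActs h)
  | _ => simp_all

theorem Proto.Regular.of_subst {P : Proto Id Label Cond} :
    ∀ {τ : ℕ → Proto Id Label Cond} {n : ℕ}, (P.subst τ).Regular → P.Free n → (τ n).Regular := by
  induction P using Proto.induct with
  | nil => simp
  | mu P hP =>
    intro τ n h hn
    simpa [Proto.regular_rename] using hP (n := n + 1) h.1 hn
  | par P Q hP hQ =>
    rintro τ n h (hn | hn)
    · exact hP h.1 hn
    · exact hQ h.2 hn
  | plus S T hS hT =>
    rintro τ n h (hn | hn)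
    · exact hS h.1 hn
    · exact hT h.2 hn
  | var n => rintro τ m h rfl; exact h
  | act id P hP => intro τ n h hn; exact hP h hn
  | pre f d o i P hP => intro τ n h hn; exact hP h hn

theorem Proto.regular_subst_of_isVar {P : Proto Id Label Cond} :
    ∀ {τ : ℕ → Proto Id Label Cond}, (∀ n, P.Free n → ∃ m, τ n = .var m) →
      ((P.subst τ).Regular ↔ P.Regular) := by
  induction P using Proto.induct with
  | nil => simp
  | mu P hP =>
    intro τ h
    have h' := Proto.lift_isVar h
    simp [hP h', Proto.voidActs_subst_of_isVar h', Proto.free_zero_subst_lift]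
  | par P Q hP hQ =>
    intro τ h
    exact and_congr (hP fun n hn => h n (.inl hn)) (hQ fun n hn => h n (.inr hn))
  | plus S T hS hT =>
    intro τ h
    exact and_congr (hS fun n hn => h n (.inl hn)) (hT fun n hn => h n (.inr hn))
  | var n =>
    intro τ h
    obtain ⟨m, e⟩ := h n rfl
    simp [e]
  | act id P hP => intro τ h; exact hP h
  | pre f d o i P hP => intro τ h; exact hP h

/-- Regularity is not stable under arbitrary substitution, since activity could be moved below a
recursion whose variable occurs. Here it is harmless: if variable `0` occurs, then `P` and hence the
unfolding are active on void protocols only, which is stronger than regularity. -/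
theorem Proto.regular_unfold (P : Proto Id Label Cond) :
    P.unfold.Regular ↔ (Proto.mu P).Regular := by
  by_cases h0 : P.Free 0
  · refine ⟨fun h => Proto.Regular.of_subst (n := 0) h h0, fun h => ?_⟩
    exact (P.voidActs_unfold.2 (h.2 h0)).regular
  · rw [Proto.unfold, Proto.regular_subst_of_isVar (Proto.unfold_isVar h0)]
    simp [h0]

theorem SCong.regular_iff {P Q : Proto Id Label Cond} (h : SCong P Q) :
    P.Regular ↔ Q.Regular := by
  induction h with
  | refl => rfl
  | symm _ ih => exact ih.symm
  | trans _ _ ih ih' => exact ih.trans ih'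
  | mu_unfold P => exact P.regular_unfold.symm
  | mu_congr h ih => simp [ih, h.free_iff, h.voidActs_iff]
  | _ => simp_all [and_comm, and_assoc]

/-! #### Guarded recursion -/

theorem Proto.varGuarded_of_not_free {P : Proto Id Label Cond} :
    ∀ {n : ℕ}, ¬ P.Free n → P.VarGuarded n := by
  induction P using Proto.induct <;> simp_all

theorem Proto.varGuarded_rename (P : Proto Id Label Cond) : ∀ (m : ℕ) (ξ : ℕ → ℕ),
    (P.rename ξ).VarGuarded m ↔ ∀ n, ξ n = m → P.VarGuarded n := by
  induction P using Proto.induct with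
  | par P Q hP hQ => intro m ξ; simp [hP, hQ, imp_and, forall_and]
  | mu P hP => intro m ξ; simp [hP, forall_nat_iff (p := fun n => _ → P.VarGuarded n)]
  | var n =>
    intro m ξ
    simp only [Proto.rename, Proto.VarGuarded]
    exact ⟨fun h k hk e => h (e ▸ hk), fun h hk => h n hk rfl⟩
  | act id P hP => intro m ξ; simp [hP]
  | _ => simp

theorem Proto.varGuarded_subst (P : Proto Id Label Cond) :
    ∀ (m : ℕ) (τ : ℕ → Proto Id Label Cond),
      (P.subst τ).VarGuarded m ↔ ∀ n, P.VarGuarded n ∨ (τ n).VarGuarded m := by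
  induction P using Proto.induct with
  | par P Q hP hQ => intro m τ; simp [hP, hQ, and_or_right, forall_and]
  | mu P hP =>
    intro m τ
    simp [hP, forall_nat_iff (p := fun n => P.VarGuarded n ∨ _), Proto.varGuarded_rename]
  | var n =>
    intro m τ
    simp only [Proto.subst_var, Proto.VarGuarded]
    constructor
    · intro h k
      by_cases e : n = k
      · exact .inr (e ▸ h)
      · exact .inl e
    · intro h
      exact (h n).resolve_left fun h => h rfl
  | act id P hP => intro m τ; simp [hP]
  | _ => simp

theorem Proto.varGuarded_unfold (P : Proto Id Label Cond) (m : ℕ) :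
    P.unfold.VarGuarded m ↔ (Proto.mu P).VarGuarded m := by
  rw [Proto.unfold, Proto.varGuarded_subst, forall_nat_iff]
  simp only [scons_zero, scons_succ, Proto.VarGuarded]
  constructor
  · rintro ⟨-, h⟩
    exact (h m).resolve_right fun h => h rfl
  · intro h
    refine ⟨.inr h, fun n => ?_⟩
    by_cases e : n = m
    · exact .inl (e ▸ h)
    · exact .inr e

theorem SCong.varGuarded_iff {P Q : Proto Id Label Cond} (h : SCong P Q) (m : ℕ) :
    P.VarGuarded m ↔ Q.VarGuarded m := by
  induction h generalizing m with
  | refl => rfl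
  | symm _ ih => exact (ih m).symm
  | trans _ _ ih ih' => exact (ih m).trans (ih' m)
  | mu_unfold P => exact (P.varGuarded_unfold m).symm
  | _ => simp_all [and_comm, and_assoc]

theorem Proto.varGuarded_zero_subst_lift (P : Proto Id Label Cond) (τ : ℕ → Proto Id Label Cond) :
    (P.subst (Proto.lift τ)).VarGuarded 0 ↔ P.VarGuarded 0 := by
  rw [Proto.varGuarded_subst, forall_nat_iff]
  simp [Proto.varGuarded_rename]

theorem Proto.varGuarded_zero_rename_lift (P : Proto Id Label Cond) (ξ : ℕ → ℕ) :
    (P.rename (scons 0 fun n => ξ n + 1)).VarGuarded 0 ↔ P.VarGuarded 0 := by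
  rw [Proto.varGuarded_rename, forall_nat_iff]
  simp

theorem Proto.guarded_rename (P : Proto Id Label Cond) :
    ∀ ξ : ℕ → ℕ, (P.rename ξ).Guarded ↔ P.Guarded := by
  induction P using Proto.induct <;> simp_all [Proto.varGuarded_zero_rename_lift]

theorem Proto.guarded_subst (P : Proto Id Label Cond) : ∀ (τ : ℕ → Proto Id Label Cond),
    (P.subst τ).Guarded ↔ P.Guarded ∧ ∀ n, P.Free n → (τ n).Guarded := by
  induction P using Proto.induct with
  | nil => simp
  | par P Q hP hQ => intro τ; simp [hP, hQ, or_imp, forall_and]; tauto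
  | mu P hP =>
    intro τ
    simp [hP, forall_nat_iff (p := fun n => P.Free n → _), Proto.guarded_rename,
      Proto.varGuarded_zero_subst_lift, and_assoc]
  | var n => simp
  | act id P hP => intro τ; simp [hP]
  | pre f d o i P hP => intro τ; simp [hP]
  | plus S T hS hT =>
    intro τ
    simp only [Proto.subst_sum, Proto.Guarded, Proto.Free] at hS hT
    simp [hS, hT, or_imp, forall_and]
    tauto

/-- From right to left, the substituted copy is `mu P` itself. From left to right, a variable that
does not occur is trivially guarded, and one that occurs has been replaced by a guarded `mu P`. -/
theorem Proto.guarded_unfold (P : Proto Id Label Cond) :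
    P.unfold.Guarded ↔ (Proto.mu P).Guarded := by
  rw [Proto.unfold, Proto.guarded_subst, forall_nat_iff]
  simp only [scons_zero, scons_succ, Proto.Guarded, imp_true_iff, and_true]
  constructor
  · rintro ⟨h, h'⟩
    refine ⟨?_, h⟩
    by_cases h0 : P.Free 0
    · exact (h' h0).1
    · exact Proto.varGuarded_of_not_free h0
  · exact fun h => ⟨h.2, fun _ => h⟩

theorem SCong.guarded_iff {P Q : Proto Id Label Cond} (h : SCong P Q) :
    P.Guarded ↔ Q.Guarded := by
  induction h with
  | refl => rfl
  | symm _ ih => exact ih.symm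
  | trans _ _ ih ih' => exact ih.trans ih'
  | mu_unfold P => exact P.guarded_unfold.symm
  | mu_congr h ih => simp [ih, h.varGuarded_iff]
  | _ => simp_all [and_comm, and_assoc]

end SyntacticProperties

/-! ### Projections and structural congruence -/

section Projections

variable {Id : Type u} {Label : Type v} {Cond : Type w}

@[simp] theorem Proto.outProj_nil (ρ : ℕ → Reaction Label Cond) :
    (Proto.nil : Proto Id Label Cond).outProj ρ = .nil := by
  rw [Proto.outProj]

@[simp] theorem Proto.outProj_par (P Q : Proto Id Label Cond) (ρ : ℕ → Reaction Label Cond) :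
    (Proto.par P Q).outProj ρ = .par (P.outProj ρ) (Q.outProj ρ) := by
  rw [Proto.outProj]

@[simp] theorem Proto.outProj_var (n : ℕ) (ρ : ℕ → Reaction Label Cond) :
    (Proto.var n : Proto Id Label Cond).outProj ρ = ρ n := by
  rw [Proto.outProj]

@[simp] theorem Proto.outProj_sum (S : Summ Id Label Cond) (ρ : ℕ → Reaction Label Cond) :
    (Proto.sum S).outProj ρ = .choice S.outProj := by
  rw [Proto.outProj]

@[simp] theorem Proto.outProj_act (id : Id) (P : Proto Id Label Cond) (ρ : ℕ → Reaction Label Cond) :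
    (Proto.act id P).outProj ρ = P.outProj ρ := by
  rw [Proto.outProj]

attribute [simp] Proto.outProj_mu Summ.outProj Proto.inProj Summ.inProj Proto.actProj Summ.actProj

mutual
  /-- The synchronisation actions of a protocol, with their directions, their conditions and the
  classes of the enabling projections of their continuations. -/
  def Proto.occs : Proto Id Label Cond → (ℕ → Reaction Label Cond) →
      List (Label × Dir × Cond × Cond × DClass Label Cond)
    | .nil, _ => []
    | .par P Q, ρ => P.occs ρ ++ Q.occs ρ
    | .mu P, ρ => P.occs (P.bind ρ)
    | .var _, _ => []
    | .sum S, ρ => S.occs ρ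
    | .act _ P, ρ => P.occs ρ
  /-- The synchronisation actions of a summation. -/
  def Summ.occs : Summ Id Label Cond → (ℕ → Reaction Label Cond) →
      List (Label × Dir × Cond × Cond × DClass Label Cond)
    | .pre f d o i P, ρ => (f, d, o, i, (P.outProj ρ).cls) :: P.occs ρ
    | .plus S T, ρ => S.occs ρ ++ T.occs ρ
end

attribute [simp] Proto.occs Summ.occs

/-! #### Renaming and substitution -/

theorem scons_comp_lift (ξ : ℕ → ℕ) (a : Reaction Label Cond) (ρ : ℕ → Reaction Label Cond) :
    (fun n => scons a ρ (scons 0 (fun k => ξ k + 1) n)) = scons a fun n => ρ (ξ n) := by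
  funext n
  cases n <;> rfl

theorem Proto.outProj_rename (P : Proto Id Label Cond) :
    ∀ (ξ : ℕ → ℕ) (ρ : ℕ → Reaction Label Cond),
      (P.rename ξ).outProj ρ = P.outProj fun n => ρ (ξ n) := by
  induction P using Proto.induct with
  | mu P hP => intro ξ ρ; simp only [Proto.rename, Proto.outProj_mu, Proto.bind, hP, scons_comp_lift]
  | plus S T hS hT =>
    intro ξ ρ
    simp only [Proto.rename, Proto.outProj_sum, Reaction.choice.injEq] at hS hT
    simp [hS ξ ρ, hT ξ ρ]
  | _ => simp_all

theorem Proto.bind_rename (P : Proto Id Label Cond) (ξ : ℕ → ℕ) (ρ : ℕ → Reaction Label Cond) :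
    (fun n => (P.rename (scons 0 fun k => ξ k + 1)).bind ρ (scons 0 (fun k => ξ k + 1) n)) =
      P.bind fun n => ρ (ξ n) := by
  simp only [Proto.bind, Proto.outProj_rename, scons_comp_lift]

theorem Proto.occs_rename (P : Proto Id Label Cond) :
    ∀ (ξ : ℕ → ℕ) (ρ : ℕ → Reaction Label Cond),
      (P.rename ξ).occs ρ = P.occs fun n => ρ (ξ n) := by
  induction P using Proto.induct with
  | mu P hP => intro ξ ρ; simp only [Proto.rename, Proto.occs, hP, Proto.bind_rename]
  | plus S T hS hT =>
    intro ξ ρ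
    simp only [Proto.rename, Proto.occs] at hS hT
    simp [hS, hT]
  | pre f d o i P hP => intro ξ ρ; simp [hP, Proto.outProj_rename]
  | _ => simp_all

theorem Proto.outProj_lift (τ : ℕ → Proto Id Label Cond) (a : Reaction Label Cond)
    (ρ : ℕ → Reaction Label Cond) :
    (fun n => (Proto.lift τ n).outProj (scons a ρ)) = scons a fun n => (τ n).outProj ρ := by
  funext n
  cases n <;> simp [Proto.outProj_rename]

theorem Proto.outProj_subst (P : Proto Id Label Cond) :
    ∀ (τ : ℕ → Proto Id Label Cond) (ρ : ℕ → Reaction Label Cond),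
      (P.subst τ).outProj ρ = P.outProj fun n => (τ n).outProj ρ := by
  induction P using Proto.induct with
  | mu P hP =>
    intro τ ρ
    simp only [Proto.subst_mu, Proto.outProj_mu, Proto.bind, hP, Proto.outProj_lift]
  | plus S T hS hT =>
    intro τ ρ
    simp only [Proto.subst_sum, Proto.outProj_sum, Reaction.choice.injEq] at hS hT
    simp [hS τ ρ, hT τ ρ]
  | _ => simp_all

theorem Proto.bind_subst (P : Proto Id Label Cond) (τ : ℕ → Proto Id Label Cond)
    (ρ : ℕ → Reaction Label Cond) :
    (fun n => (Proto.lift τ n).outProj ((P.subst (Proto.lift τ)).bind ρ)) =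
      P.bind fun n => (τ n).outProj ρ := by
  simp only [Proto.bind, Proto.outProj_subst, Proto.outProj_lift]

/-- Only membership is described: a variable that occurs several times contributes its actions
several times. The mapping in the first disjunct sends each variable to the enabling projection of
its substitute. -/
theorem Proto.mem_occs_subst (P : Proto Id Label Cond) (x) :
    ∀ (τ : ℕ → Proto Id Label Cond) (ρ : ℕ → Reaction Label Cond),
      x ∈ (P.subst τ).occs ρ ↔
        x ∈ P.occs (fun n => (τ n).outProj ρ) ∨ ∃ n, P.Free n ∧ x ∈ (τ n).occs ρ := by
  induction P using Proto.induct with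
  | nil => simp
  | par P Q hP hQ => intro τ ρ; simp [hP, hQ, or_and_right, exists_or, or_or_or_comm]
  | mu P hP =>
    intro τ ρ
    simp only [Proto.subst_mu, Proto.occs, hP, Proto.bind_subst]
    rw [exists_nat_iff]
    simp [Proto.occs_rename, Proto.bind]
  | var n => simp
  | act id P hP => intro τ ρ; simp [hP]
  | pre f d o i P hP => intro τ ρ; simp [hP, Proto.outProj_subst, or_assoc]
  | plus S T hS hT =>
    intro τ ρ
    simp only [Proto.subst_sum, Proto.occs, Proto.Free] at hS hT
    simp [hS, hT, or_and_right, exists_or, or_or_or_comm]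

/-- For guarded recursion, the mapping extended by the recursion body is the mapping that the
unfolding induces. -/
theorem Proto.outProj_unfold_env (P : Proto Id Label Cond) (h : P.VarGuarded 0)
    (ρ : ℕ → Reaction Label Cond) :
    (fun n => ((scons (.mu P) .var : ℕ → Proto Id Label Cond) n).outProj ρ) = P.bind ρ := by
  funext n
  cases n with
  | zero =>
    have := P.bind_zero ρ h
    simp only [Proto.outProj_var] at this
    simp [this]
  | succ n => simp [Proto.bind]

theorem Proto.outProj_unfold (P : Proto Id Label Cond) (h : P.VarGuarded 0)
    (ρ : ℕ → Reaction Label Cond) : P.unfold.outProj ρ = (Proto.mu P).outProj ρ := by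
  rw [Proto.unfold, Proto.outProj_subst, P.outProj_unfold_env h, Proto.outProj_mu]

/-- The copies of `mu P` in the unfolding contribute actions that the outer body has already.
Guardedness is what makes the two mappings equal, and with them the recorded continuations. -/
theorem Proto.mem_occs_unfold (P : Proto Id Label Cond) (h : P.VarGuarded 0)
    (ρ : ℕ → Reaction Label Cond) (x) : x ∈ P.unfold.occs ρ ↔ x ∈ (Proto.mu P).occs ρ := by
  rw [Proto.unfold, Proto.mem_occs_subst, P.outProj_unfold_env h, exists_nat_iff]
  simp only [scons_zero, scons_succ, Proto.occs, List.not_mem_nil, and_false, exists_false, or_false]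
  tauto

/-! #### Congruent mappings -/

theorem Proto.outProj_cls_congr (P : Proto Id Label Cond) :
    ∀ {ρ ρ' : ℕ → Reaction Label Cond}, (∀ n, (ρ n).cls = (ρ' n).cls) →
      (P.outProj ρ).cls = (P.outProj ρ').cls := by
  induction P using Proto.induct with
  | mu P hP =>
    intro ρ ρ' h
    simp only [Proto.outProj_mu]
    refine hP (forall_nat_iff.2 ⟨?_, h⟩)
    exact hP (forall_nat_iff.2 ⟨rfl, h⟩)
  | par P Q hP hQ => intro ρ ρ' h; simp [hP h, hQ h]
  | var n => intro ρ ρ' h; simp [h]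
  | act id P hP => intro ρ ρ' h; simp [hP h]
  | _ => simp

theorem Proto.bind_cls_congr (P : Proto Id Label Cond) {ρ ρ' : ℕ → Reaction Label Cond}
    (h : ∀ n, (ρ n).cls = (ρ' n).cls) (n : ℕ) : (P.bind ρ n).cls = (P.bind ρ' n).cls := by
  revert n
  exact forall_nat_iff.2 ⟨P.outProj_cls_congr (forall_nat_iff.2 ⟨rfl, h⟩), h⟩

theorem Proto.occs_congr (P : Proto Id Label Cond) :
    ∀ {ρ ρ' : ℕ → Reaction Label Cond}, (∀ n, (ρ n).cls = (ρ' n).cls) → P.occs ρ = P.occs ρ' := by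
  induction P using Proto.induct with
  | mu P hP => intro ρ ρ' h; exact hP (P.bind_cls_congr h)
  | par P Q hP hQ => intro ρ ρ' h; simp [hP h, hQ h]
  | act id P hP => intro ρ ρ' h; simp [hP h]
  | pre f d o i P hP => intro ρ ρ' h; simp [hP h, P.outProj_cls_congr h]
  | plus S T hS hT =>
    intro ρ ρ' h
    simp only [Proto.occs] at hS hT
    simp [hS h, hT h]
  | _ => simp

/-! #### Structural congruence -/

/-- Guardedness is needed for `mu_unfold` alone, where the memorised projection of the body must be
the one that unfolding induces. Since the enabling projection stops at the first action, a change of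
continuation is invisible to it. -/
theorem SCong.outProj_cls {P Q : Proto Id Label Cond} (h : SCong P Q) (hP : P.Guarded)
    (ρ : ℕ → Reaction Label Cond) : (P.outProj ρ).cls = (Q.outProj ρ).cls := by
  induction h generalizing ρ with
  | refl => rfl
  | symm h ih => exact (ih (h.guarded_iff.2 hP) ρ).symm
  | trans h _ ih ih' => exact (ih hP ρ).trans (ih' (h.guarded_iff.1 hP) ρ)
  | par_congr _ _ ih ih' => simp [ih hP.1 ρ, ih' hP.2 ρ]
  | @mu_congr P P' h ih =>
    simp only [Proto.outProj_mu]
    rw [ih hP.2]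
    refine P'.outProj_cls_congr (forall_nat_iff.2 ⟨ih hP.2 _, fun n => rfl⟩)
  | act_congr id _ ih => simpa using ih hP ρ
  | pre_congr => simp
  | plus_congr _ _ ih ih' =>
    simp only [Proto.outProj_sum] at ih ih'
    exact Reaction.cls_plus_congr (ih hP.1 ρ) (ih' hP.2 ρ)
  | mu_unfold P => rw [P.outProj_unfold hP.1]
  | plus_assoc => exact Defn.cls_eq.2 (.plus_assoc _ _ _)
  | plus_comm => exact Defn.cls_eq.2 (.plus_comm _ _)
  | par_assoc | par_comm | par_nil | act_par | act_act | act_nil =>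
    simp [add_comm, add_assoc]

/-- Multiplicities are not invariant because of `mu_unfold`. Recording continuations as classes
turns the case `pre_congr` into an equality of entries. -/
theorem SCong.mem_occs_iff {P Q : Proto Id Label Cond} (h : SCong P Q) (hP : P.Guarded)
    (ρ : ℕ → Reaction Label Cond) (x) : x ∈ P.occs ρ ↔ x ∈ Q.occs ρ := by
  induction h generalizing ρ with
  | refl => rfl
  | symm h ih => exact (ih (h.guarded_iff.2 hP) ρ).symm
  | trans h _ ih ih' => exact (ih hP ρ).trans (ih' (h.guarded_iff.1 hP) ρ)
  | par_congr _ _ ih ih' => simp [ih hP.1 ρ, ih' hP.2 ρ]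
  | @mu_congr P P' h ih =>
    simp only [Proto.occs]
    have e : ∀ n, (P.bind ρ n).cls = (P'.bind ρ n).cls :=
      forall_nat_iff.2 ⟨h.outProj_cls hP.2 _, fun n => rfl⟩
    rw [ih hP.2, P'.occs_congr e]
  | act_congr id _ ih => simpa using ih hP ρ
  | pre_congr f d o i h ih => simp [ih hP, h.outProj_cls hP]
  | plus_congr _ _ ih ih' =>
    simp only [Proto.occs] at ih ih'
    simp [ih hP.1 ρ, ih' hP.2 ρ]
  | mu_unfold P => rw [P.mem_occs_unfold hP.1]
  | plus_assoc | plus_comm | par_assoc | par_comm | par_nil | act_par | act_act | act_nil =>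
    simp [or_comm]

/-! #### The reactive projection -/

/-- Somewhere in its parallel composition the reactive projection has an input for the given entry,
with a continuation congruent to `R`. The additional copy is absorbed there. -/
theorem Proto.inProj_absorb (P : Proto Id Label Cond) {f d o i} {R : Reaction Label Cond} :
    ∀ {ρ : ℕ → Reaction Label Cond}, (f, d, o, i, R.cls) ∈ P.occs ρ →
      (P.inProj ρ).cls + (Defn.inp i f d R).cls = (P.inProj ρ).cls := by
  induction P using Proto.induct with
  | mu P hP => intro ρ h; exact hP h
  | par P Q hP hQ =>
    intro ρ h
    simp only [Proto.occs, List.mem_append] at h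
    simp only [Proto.inProj, Defn.cls_par]
    rcases h with h | h
    · rw [add_right_comm, hP h]
    · rw [add_assoc, hQ h]
  | act id P hP => intro ρ h; exact hP h
  | pre f' d' o' i' P hP =>
    intro ρ h
    simp only [Proto.occs, Summ.occs, List.mem_cons, Prod.mk.injEq] at h
    simp only [Proto.inProj, Summ.inProj, Defn.cls_par]
    rcases h with ⟨rfl, rfl, rfl, rfl, h⟩ | h
    · rw [add_right_comm, Defn.cls_inp_congr _ _ _ h, Defn.cls_inp_absorb]
    · rw [add_assoc, hP h]
  | plus S T hS hT =>
    intro ρ h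
    simp only [Proto.occs, Summ.occs, List.mem_append] at h hS hT
    simp only [Proto.inProj, Summ.inProj, Defn.cls_par] at hS hT ⊢
    rcases h with h | h
    · rw [add_right_comm, hS h]
    · rw [add_assoc, hT h]
  | _ => simp

/-- The reactive projection of `P` is a parallel composition of inputs, and these are absorbed one
at a time. -/
theorem Proto.inProj_absorb_inProj (P : Proto Id Label Cond) {Q : Proto Id Label Cond}
    {ρ' : ℕ → Reaction Label Cond} : ∀ {ρ : ℕ → Reaction Label Cond},
      (∀ x ∈ P.occs ρ, x ∈ Q.occs ρ') →
        (Q.inProj ρ').cls + (P.inProj ρ).cls = (Q.inProj ρ').cls := by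
  induction P using Proto.induct with
  | mu P hP => intro ρ h; exact hP h
  | par P Q hP hQ =>
    intro ρ h
    simp only [Proto.occs, List.mem_append] at h
    simp only [Proto.inProj, Defn.cls_par]
    rw [← add_assoc, hP fun x hx => h x (.inl hx), hQ fun x hx => h x (.inr hx)]
  | act id P hP => intro ρ h; exact hP h
  | pre f' d' o' i' P hP =>
    intro ρ h
    simp only [Proto.occs, Summ.occs, List.mem_cons] at h
    simp only [Proto.inProj, Summ.inProj, Defn.cls_par]
    rw [← add_assoc, Q.inProj_absorb (h _ (.inl rfl)), hP fun x hx => h x (.inr hx)]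
  | plus S T hS hT =>
    intro ρ h
    simp only [Proto.occs, Summ.occs, List.mem_append] at h hS hT
    simp only [Proto.inProj, Summ.inProj, Defn.cls_par] at hS hT ⊢
    rw [← add_assoc, hS fun x hx => h x (.inl hx), hT fun x hx => h x (.inr hx)]
  | _ => simp

/-- The reactive projection is determined by the set of actions. -/
theorem Proto.inProj_cls_eq {P Q : Proto Id Label Cond} {ρ ρ' : ℕ → Reaction Label Cond}
    (h : ∀ x, x ∈ P.occs ρ ↔ x ∈ Q.occs ρ') : (P.inProj ρ).cls = (Q.inProj ρ').cls := by
  rw [← Q.inProj_absorb_inProj fun x => (h x).2, add_comm,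
    P.inProj_absorb_inProj fun x => (h x).1]

/-- A parallel composition of inputs has no output to synchronise with, so it can only fire an
input. That input persists, and its continuation is added. -/
theorem Proto.inProj_step (M : Model.{u, v, w} Id Label) (P : Proto Id Label M.Cond) :
    ∀ {ρ : ℕ → Reaction Label M.Cond} {α D'}, DStep M (P.inProj ρ) α D' →
      ∃ f d o i r, (f, d, o, i, r) ∈ P.occs ρ ∧ α = .inp i f d ∧
        D'.cls = (P.inProj ρ).cls + r := by
  induction P using Proto.induct with
  | nil => intro ρ α D' h; simp only [Proto.inProj] at h; cases h
  | var n => intro ρ α D' h; simp only [Proto.inProj] at h; cases h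
  | mu P hP => intro ρ α D' h; exact hP h
  | act id P hP => intro ρ α D' h; simp only [Proto.inProj] at h; exact hP h
  | par P Q hP hQ =>
    intro ρ α D' h
    simp only [Proto.inProj] at h
    cases h with
    | int_left h =>
      obtain ⟨f, d, o, i, r, hx, rfl, e⟩ := hP h
      exact ⟨f, d, o, i, r, by simp [hx], rfl, by simp [e, add_right_comm]⟩
    | int_right h =>
      obtain ⟨f, d, o, i, r, hx, rfl, e⟩ := hQ h
      exact ⟨f, d, o, i, r, by simp [hx], rfl, by simp [e, add_assoc]⟩
    | self_left h =>
      obtain ⟨f, d, o, i, r, hx, e, -⟩ := hP h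
      cases e
    | self_right _ h =>
      obtain ⟨f, d, o, i, r, hx, e, -⟩ := hQ h
      cases e
  | pre f' d' o' i' P hP =>
    intro ρ α D' h
    simp only [Proto.inProj, Summ.inProj] at h
    cases h with
    | int_left h =>
      cases h
      exact ⟨f', d', o', i', _, by simp; exact .inl rfl, rfl, by
        simp [add_right_comm, add_comm (P.outProj ρ).cls]⟩
    | int_right h =>
      obtain ⟨f, d, o, i, r, hx, rfl, e⟩ := hP h
      exact ⟨f, d, o, i, r, by simp [hx], rfl, by simp [e, add_assoc]⟩
    | self_left h => cases h
    | self_right _ h =>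
      obtain ⟨f, d, o, i, r, hx, e, -⟩ := hP h
      cases e
  | plus S T hP hQ =>
    intro ρ α D' h
    simp only [Proto.inProj, Summ.inProj] at h hP hQ
    cases h with
    | int_left h =>
      obtain ⟨f, d, o, i, r, hx, rfl, e⟩ := hP h
      simp only [Proto.occs] at hx
      exact ⟨f, d, o, i, r, by simp [hx], rfl, by simp [e, add_right_comm]⟩
    | int_right h =>
      obtain ⟨f, d, o, i, r, hx, rfl, e⟩ := hQ h
      simp only [Proto.occs] at hx
      exact ⟨f, d, o, i, r, by simp [hx], rfl, by simp [e, add_assoc]⟩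
    | self_left h =>
      obtain ⟨f, d, o, i, r, hx, e, -⟩ := hP h
      cases e
    | self_right _ h =>
      obtain ⟨f, d, o, i, r, hx, e, -⟩ := hQ h
      cases e

theorem Proto.inProj_can_step (M : Model.{u, v, w} Id Label) (P : Proto Id Label M.Cond)
    {f d o i r} : ∀ {ρ : ℕ → Reaction Label M.Cond}, (f, d, o, i, r) ∈ P.occs ρ →
      ∃ D', DStep M (P.inProj ρ) (.inp i f d) D' ∧ D'.cls = (P.inProj ρ).cls + r := by
  induction P using Proto.induct with
  | nil => simp
  | var n => simp
  | mu P hP => intro ρ h; exact hP h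
  | act id P hP => intro ρ h; exact hP h
  | par P Q hP hQ =>
    intro ρ h
    simp only [Proto.occs, List.mem_append] at h
    rcases h with h | h
    · obtain ⟨D', h, e⟩ := hP h
      exact ⟨_, .int_left h, by simp [e, add_right_comm]⟩
    · obtain ⟨D', h, e⟩ := hQ h
      exact ⟨_, .int_right h, by simp [e, add_assoc]⟩
  | pre f' d' o' i' P hP =>
    intro ρ h
    simp only [Proto.occs, Summ.occs, List.mem_cons, Prod.mk.injEq] at h
    rcases h with ⟨rfl, rfl, rfl, rfl, rfl⟩ | h
    · exact ⟨_, .int_left (.inp _ _ _ _), by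
        simp [add_right_comm, add_comm (P.outProj ρ).cls]⟩
    · obtain ⟨D', h, e⟩ := hP h
      exact ⟨_, .int_right h, by simp [e, add_assoc]⟩
  | plus S T hP hQ =>
    intro ρ h
    simp only [Proto.occs, Summ.occs, List.mem_append] at h hP hQ
    rcases h with h | h
    · obtain ⟨D', h, e⟩ := hP h
      exact ⟨_, .int_left h, by simp only [Proto.inProj, Summ.inProj] at e ⊢; simp [e, add_right_comm]⟩
    · obtain ⟨D', h, e⟩ := hQ h
      exact ⟨_, .int_right h, by simp only [Proto.inProj, Summ.inProj] at e ⊢; simp [e, add_assoc]⟩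

/-! #### The active projection -/

theorem Proto.Void.outProj_cls {P : Proto Id Label Cond} : P.Void →
    ∀ (ρ : ℕ → Reaction Label Cond), (P.outProj ρ).cls = 0 := by
  induction P using Proto.induct <;> simp_all

variable [DecidableEq Id]

theorem Proto.Void.actProj_cls {P : Proto Id Label Cond} (id : Id) : P.Void →
    ∀ (ρ : ℕ → Reaction Label Cond), (P.actProj id ρ).cls = 0 := by
  induction P using Proto.induct with
  | act id' P hP =>
    intro h ρ
    rw [Proto.actProj]
    split_ifs
    · simp [hP h, Proto.Void.outProj_cls (P := P) h]
    · exact hP h ρ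
  | _ => simp_all

theorem Proto.VoidActs.actProj_cls {P : Proto Id Label Cond} (id : Id) : P.VoidActs →
    ∀ (ρ : ℕ → Reaction Label Cond), (P.actProj id ρ).cls = 0 := by
  induction P using Proto.induct with
  | act id' P hP => intro h ρ; exact Proto.Void.actProj_cls (P := .act id' P) id h ρ
  | _ => simp_all

theorem Proto.actProj_cls_congr (id : Id) (P : Proto Id Label Cond) :
    ∀ {ρ ρ' : ℕ → Reaction Label Cond}, (∀ n, (ρ n).cls = (ρ' n).cls) →
      (P.actProj id ρ).cls = (P.actProj id ρ').cls := by
  induction P using Proto.induct with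
  | mu P hP => intro ρ ρ' h; exact hP (P.bind_cls_congr h)
  | par P Q hP hQ => intro ρ ρ' h; simp [hP h, hQ h]
  | act id' P hP =>
    intro ρ ρ' h
    simp only [Proto.actProj]
    split_ifs
    · simp [hP h, P.outProj_cls_congr h]
    · exact hP h
  | pre f d o i P hP => intro ρ ρ' h; exact hP h
  | plus S T hS hT =>
    intro ρ ρ' h
    simp only [Proto.actProj] at hS hT
    simp [hS h, hT h]
  | _ => simp

/-- The restriction to renamings is needed: a variable has active projection `nil`, whereas a
protocol put in its place might contain active nodes. -/
theorem Proto.actProj_subst_of_isVar (id : Id) (P : Proto Id Label Cond) :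
    ∀ {τ : ℕ → Proto Id Label Cond} (ρ : ℕ → Reaction Label Cond),
      (∀ n, P.Free n → ∃ m, τ n = .var m) →
        (P.subst τ).actProj id ρ = P.actProj id fun n => (τ n).outProj ρ := by
  induction P using Proto.induct with
  | nil => simp
  | mu P hP =>
    intro τ ρ h
    simp only [Proto.subst_mu, Proto.actProj, hP _ (Proto.lift_isVar h), Proto.bind_subst]
  | par P Q hP hQ =>
    intro τ ρ h
    simp [hP ρ fun n hn => h n (.inl hn), hQ ρ fun n hn => h n (.inr hn)]
  | var n =>
    intro τ ρ h
    obtain ⟨m, e⟩ := h n rfl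
    simp [e]
  | act id' P hP => intro τ ρ h; simp [hP ρ h, Proto.outProj_subst]
  | pre f d o i P hP => intro τ ρ h; exact hP ρ h
  | plus S T hS hT =>
    intro τ ρ h
    simp only [Proto.subst_sum, Proto.actProj] at hS hT
    simp [hS ρ fun n hn => h n (.inl hn), hT ρ fun n hn => h n (.inr hn)]

/-- This is where regularity pays off. If the variable occurs, the body is active on void protocols
only and both sides are zero. Otherwise unfolding is a renaming and duplicates nothing. -/
theorem Proto.actProj_unfold_cls (id : Id) {P : Proto Id Label Cond} (hG : P.VarGuarded 0)
    (hR : P.Free 0 → P.VoidActs) (ρ : ℕ → Reaction Label Cond) :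
    (P.unfold.actProj id ρ).cls = ((Proto.mu P).actProj id ρ).cls := by
  by_cases h0 : P.Free 0
  · have h := hR h0
    rw [Proto.VoidActs.actProj_cls id (P.voidActs_unfold.2 h),
      Proto.VoidActs.actProj_cls (P := .mu P) id h]
  · rw [Proto.unfold, Proto.actProj_subst_of_isVar id P ρ (Proto.unfold_isVar h0),
      P.outProj_unfold_env hG, Proto.actProj]

theorem SCong.actProj_cls {P Q : Proto Id Label Cond} (h : SCong P Q) (hP : P.Guarded)
    (hR : P.Regular) (id : Id) (ρ : ℕ → Reaction Label Cond) :
    (P.actProj id ρ).cls = (Q.actProj id ρ).cls := by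
  induction h generalizing ρ with
  | refl => rfl
  | symm h ih => exact (ih (h.guarded_iff.2 hP) (h.regular_iff.2 hR) ρ).symm
  | trans h _ ih ih' => exact (ih hP hR ρ).trans (ih' (h.guarded_iff.1 hP) (h.regular_iff.1 hR) ρ)
  | par_congr _ _ ih ih' => simp [ih hP.1 hR.1 ρ, ih' hP.2 hR.2 ρ]
  | @mu_congr P P' h ih =>
    simp only [Proto.actProj]
    rw [ih hP.2 hR.1]
    exact P'.actProj_cls_congr id (forall_nat_iff.2 ⟨h.outProj_cls hP.2 _, fun n => rfl⟩)
  | act_congr id' h ih =>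
    simp only [Proto.actProj]
    split_ifs
    · simp [ih hP hR, h.outProj_cls hP]
    · exact ih hP hR ρ
  | pre_congr f d o i h ih => exact ih hP hR ρ
  | plus_congr _ _ ih ih' =>
    simp only [Proto.actProj] at ih ih'
    simp [ih hP.1 hR.1 ρ, ih' hP.2 hR.2 ρ]
  | mu_unfold P => exact (Proto.actProj_unfold_cls id hP.1 hR.2 ρ).symm
  | plus_assoc | plus_comm | par_assoc | par_comm | par_nil => simp [add_comm, add_assoc]
  | act_nil id' => simp only [Proto.actProj]; split_ifs <;> simp
  | act_par id' P Q =>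
    simp only [Proto.actProj]
    split_ifs <;> simp [add_add_add_comm]
  | act_act id₁ id₂ P =>
    simp only [Proto.actProj, Proto.outProj_act]
    split_ifs <;> simp

end Projections

/-! ### The effect of a reduction on the projections -/

section ActSteps

variable {Id : Type u} {Label : Type v} {Cond : Type w}

/-- The redex `[o]f^d[i]` of the active node `id` is contracted and the nodes in `I` become active on
its continuation. -/
inductive ActStep (id : Id) (f : Label) (d : Dir) (o i : Cond) (I : List Id) :
    Proto Id Label Cond → Proto Id Label Cond → Prop
  | base (P S) : ActStep id f d o i I (.act id (.sum ((Summ.pre f d o i P).plusOpt S)))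
      (.sum ((Summ.pre f d o i (P.acts I)).plusOpt S))
  | synch (f' d' o' i') {P Q} : ActStep id f d o i I P Q →
      ActStep id f d o i I (.sum (.pre f' d' o' i' P)) (.sum (.pre f' d' o' i' Q))
  | act (id') {P Q} : ActStep id f d o i I P Q → ActStep id f d o i I (.act id' P) (.act id' Q)
  | sum (T) {S S'} : ActStep id f d o i I (.sum S) (.sum S') →
      ActStep id f d o i I (.sum (.plus S T)) (.sum (.plus S' T))
  | par (R) {P Q} : ActStep id f d o i I P Q → ActStep id f d o i I (.par P R) (.par Q R)
  | struct {P P' Q' Q} : SCong P P' → ActStep id f d o i I P' Q' → SCong Q' Q →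
      ActStep id f d o i I P Q

theorem ActStep.of_scong {id : Id} {f : Label} {d : Dir} {o i : Cond} {I : List Id}
    {P P' Q : Proto Id Label Cond} (h : SCong P P') (h' : ActStep id f d o i I P' Q) :
    ActStep id f d o i I P Q :=
  .struct h h' (.refl _)

/-- The network state `Δ` allows the enabling node `id` and the reacting nodes `I` to synchronise, with
resulting network state `Δ'`. -/
def Enabled [DecidableEq Id] (M : Model.{u, v, w} Id Label) (Δ Δ' : NetState Id) (id : Id) (f : Label)
    (d : Dir) (o i : M.Cond) (I : List Id) : Prop :=
  ∃ s, Δ.lookup id = some s ∧ M.Sat s o ∧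
    ((∃ id' s', BinTarget d s id' ∧ Δ.lookup id' = some s' ∧ M.Sat s' i ∧ id ≠ id' ∧ I = [id'] ∧
        Δ' = Δ.upd M f d id s id' s') ∨
      (d = .star ∧ I.Nodup ∧
        (∀ id', id' ∈ I ↔ ∃ s', Δ.lookup id' = some s' ∧ s'.source = id ∧ M.Sat s' i) ∧ Δ' = Δ) ∨
      (d = .self ∧ M.Sat s i ∧ I = [id] ∧ Δ' = Δ))

theorem Enabled.nodup [DecidableEq Id] {M : Model.{u, v, w} Id Label} {Δ Δ' : NetState Id} {id : Id}
    {f : Label} {d : Dir} {o i : M.Cond} {I : List Id} (h : Enabled M Δ Δ' id f d o i I) :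
    I.Nodup := by
  obtain ⟨s, -, -, ⟨id', s', -, -, -, -, rfl, -⟩ | ⟨-, h, -⟩ | ⟨-, -, rfl, -⟩⟩ := h
  · simp
  · exact h
  · simp

/-- As `P.acts [id']` is `.act id' P` by definition, the three axioms of reduction become one
contraction with different lists `I`. Together with `ActStep.red`, this separates syntax from
states. -/
theorem Red.exists_actStep [DecidableEq Id] {M : Model.{u, v, w} Id Label} {Δ Δ' : NetState Id}
    {P Q : Proto Id Label M.Cond} (h : Red M Δ P Δ' Q) :
    ∃ id f d o i I, Enabled M Δ Δ' id f d o i I ∧ ActStep id f d o i I P Q := by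
  induction h with
  | bin h ho hd h' hi hne =>
    exact ⟨_, _, _, _, _, _, ⟨_, h, ho, .inl ⟨_, _, hd, h', hi, hne, rfl, rfl⟩⟩, .base _ _⟩
  | brd h ho hI hI' =>
    exact ⟨_, _, _, _, _, _, ⟨_, h, ho, .inr (.inl ⟨rfl, hI, hI', rfl⟩)⟩, .base _ _⟩
  | loc h ho hi =>
    exact ⟨_, _, _, _, _, _, ⟨_, h, ho, .inr (.inr ⟨rfl, hi, rfl, rfl⟩)⟩, .base _ _⟩
  | synch _ ih =>
    obtain ⟨_, _, _, _, _, _, h, h'⟩ := ih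
    exact ⟨_, _, _, _, _, _, h, .synch _ _ _ _ h'⟩
  | act _ ih =>
    obtain ⟨_, _, _, _, _, _, h, h'⟩ := ih
    exact ⟨_, _, _, _, _, _, h, .act _ h'⟩
  | sum _ ih =>
    obtain ⟨_, _, _, _, _, _, h, h'⟩ := ih
    exact ⟨_, _, _, _, _, _, h, .sum _ h'⟩
  | par _ ih =>
    obtain ⟨_, _, _, _, _, _, h, h'⟩ := ih
    exact ⟨_, _, _, _, _, _, h, .par _ h'⟩
  | struct e _ e' ih =>
    obtain ⟨_, _, _, _, _, _, h, h'⟩ := ih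
    exact ⟨_, _, _, _, _, _, h, .struct e h' e'⟩

theorem ActStep.red [DecidableEq Id] {M : Model.{u, v, w} Id Label} {Δ Δ' : NetState Id}
    {P Q : Proto Id Label M.Cond} {id : Id} {f : Label} {d : Dir} {o i : M.Cond} {I : List Id}
    (h : ActStep id f d o i I P Q) (hE : Enabled M Δ Δ' id f d o i I) : Red M Δ P Δ' Q := by
  induction h with
  | base P S =>
    obtain ⟨s, h, ho, ⟨id', s', hd, h', hi, hne, rfl, rfl⟩ | ⟨rfl, hI, hI', rfl⟩ |
      ⟨rfl, hi, rfl, rfl⟩⟩ := hE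
    · exact .bin h ho hd h' hi hne
    · exact .brd h ho hI hI'
    · exact .loc h ho hi
  | synch _ _ _ _ _ ih => exact .synch ih
  | act _ _ ih => exact .act ih
  | sum _ _ ih => exact .sum ih
  | par _ _ ih => exact .par ih
  | struct e _ e' ih => exact .struct e ih e'

theorem Proto.regular_acts (I : List Id) (P : Proto Id Label Cond) :
    (P.acts I).Regular ↔ P.Regular := by
  induction I with
  | nil => rfl
  | cons id I ih => exact ih

theorem Proto.guarded_acts (I : List Id) (P : Proto Id Label Cond) :
    (P.acts I).Guarded ↔ P.Guarded := by
  induction I with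
  | nil => rfl
  | cons id I ih => exact ih

theorem Proto.outProj_acts (I : List Id) (P : Proto Id Label Cond) (ρ : ℕ → Reaction Label Cond) :
    (P.acts I).outProj ρ = P.outProj ρ := by
  induction I with
  | nil => rfl
  | cons id I ih => simpa [Proto.acts] using ih

theorem Proto.occs_acts (I : List Id) (P : Proto Id Label Cond) (ρ : ℕ → Reaction Label Cond) :
    (P.acts I).occs ρ = P.occs ρ := by
  induction I with
  | nil => rfl
  | cons id I ih => simpa [Proto.acts] using ih

theorem ActStep.regular {id : Id} {f : Label} {d : Dir} {o i : Cond} {I : List Id}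
    {P Q : Proto Id Label Cond} (h : ActStep id f d o i I P Q) (hP : P.Regular) : Q.Regular := by
  induction h with
  | base P S => cases S <;> simpa [Summ.plusOpt, Proto.regular_acts] using hP
  | synch _ _ _ _ _ ih => exact ih hP
  | act _ _ ih => exact ih hP
  | sum _ _ ih => exact ⟨ih hP.1, hP.2⟩
  | par _ _ ih => exact ⟨ih hP.1, hP.2⟩
  | struct e _ e' ih => exact e'.regular_iff.1 (ih (e.regular_iff.1 hP))

theorem ActStep.guarded {id : Id} {f : Label} {d : Dir} {o i : Cond} {I : List Id}
    {P Q : Proto Id Label Cond} (h : ActStep id f d o i I P Q) (hP : P.Guarded) : Q.Guarded := by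
  induction h with
  | base P S => cases S <;> simpa [Summ.plusOpt, Proto.guarded_acts] using hP
  | synch _ _ _ _ _ ih => exact ih hP
  | act _ _ ih => exact ih hP
  | sum _ _ ih => exact ⟨ih hP.1, hP.2⟩
  | par _ _ ih => exact ⟨ih hP.1, hP.2⟩
  | struct e _ e' ih => exact e'.guarded_iff.1 (ih (e.guarded_iff.1 hP))

variable [DecidableEq Id]

/-- Repetitions in `I` must be excluded: outputs, unlike inputs, are not idempotent, and a repeated
identifier would add the enabling projection a second time. -/
theorem Proto.actProj_acts {I : List Id} (hI : I.Nodup) (P : Proto Id Label Cond) (j : Id)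
    (ρ : ℕ → Reaction Label Cond) :
    ((P.acts I).actProj j ρ).cls =
      (P.actProj j ρ).cls + if j ∈ I then (P.outProj ρ).cls else 0 := by
  induction I with
  | nil => simp [Proto.acts]
  | cons id I ih =>
    have e : P.acts (id :: I) = .act id (P.acts I) := rfl
    have ih := ih (List.nodup_cons.1 hI).2
    rw [e, Proto.actProj]
    split_ifs with h h' h'
    · subst h
      simp [ih, Proto.outProj_acts, (List.nodup_cons.1 hI).1]
    · simp [h] at h'
    · simp [ih, (List.mem_cons.1 h').resolve_left (Ne.symm h)]
    · have hj : j ∉ I := fun hj => h' (List.mem_cons_of_mem _ hj)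
      simp [ih, hj]

/-- The effect of the contraction of a redex on the projections: the enabling and the reactive
projection stay the same, the behaviour of the enabling node becomes `a`, and the reacting nodes `I`
gain the behaviour `r`. -/
structure Effect (ρ : ℕ → Reaction Label Cond) (id : Id) (f : Label) (d : Dir) (o i : Cond)
    (I : List Id) (r a : DClass Label Cond) (P Q : Proto Id Label Cond) : Prop where
  outProj : (Q.outProj ρ).cls = (P.outProj ρ).cls
  occs : ∀ x, x ∈ Q.occs ρ ↔ x ∈ P.occs ρ
  mem : (f, d, o, i, r) ∈ P.occs ρ
  self : (Q.actProj id ρ).cls = a + if id ∈ I then r else 0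
  other : ∀ j, j ≠ id → (Q.actProj j ρ).cls = (P.actProj j ρ).cls + if j ∈ I then r else 0

namespace Effect

variable {ρ : ℕ → Reaction Label Cond} {id : Id} {f : Label} {d : Dir} {o i : Cond}
  {I : List Id} {r a : DClass Label Cond} {P Q : Proto Id Label Cond}

theorem base (ρ : ℕ → Reaction Label Cond) (id : Id) (f : Label) (d : Dir) (o i : Cond)
    (hI : I.Nodup) (P : Proto Id Label Cond) (S : Option (Summ Id Label Cond)) :
    Effect ρ id f d o i I (P.outProj ρ).cls
      ((Proto.sum ((Summ.pre f d o i P).plusOpt S)).actProj id ρ).cls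
      (.act id (.sum ((Summ.pre f d o i P).plusOpt S)))
      (.sum ((Summ.pre f d o i (P.acts I)).plusOpt S)) where
  outProj := by cases S <;> simp [Summ.plusOpt]
  occs x := by cases S <;> simp [Summ.plusOpt, Proto.outProj_acts, Proto.occs_acts]
  mem := by cases S <;> simp [Summ.plusOpt]
  self := by
    cases S <;> simp [Summ.plusOpt, Proto.actProj_acts hI, add_right_comm]
  other j hj := by
    cases S <;> simp [Summ.plusOpt, Proto.actProj_acts hI, add_right_comm, Ne.symm hj]

theorem pre (f' d' o' i') (h : Effect ρ id f d o i I r a P Q) :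
    Effect ρ id f d o i I r a (.sum (.pre f' d' o' i' P)) (.sum (.pre f' d' o' i' Q)) where
  outProj := by simp
  occs x := by simp [h.occs, h.outProj]
  mem := by simp [h.mem]
  self := h.self
  other := h.other

theorem act_self (h : Effect ρ id f d o i I r a P Q) :
    Effect ρ id f d o i I r (a + (P.outProj ρ).cls) (.act id P) (.act id Q) where
  outProj := by simpa using h.outProj
  occs x := by simpa using h.occs x
  mem := by simpa using h.mem
  self := by simp [h.self, h.outProj, add_right_comm]
  other j hj := by simpa [Ne.symm hj] using h.other j hj

theorem act_other {id' : Id} (hne : id' ≠ id) (h : Effect ρ id f d o i I r a P Q) :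
    Effect ρ id f d o i I r a (.act id' P) (.act id' Q) where
  outProj := by simpa using h.outProj
  occs x := by simpa using h.occs x
  mem := by simpa using h.mem
  self := by simp [h.self, hne]
  other j hj := by
    simp only [Proto.actProj]
    split_ifs <;> simp_all [add_right_comm, h.other j hj, h.outProj]

theorem par (R : Proto Id Label Cond) (h : Effect ρ id f d o i I r a P Q) :
    Effect ρ id f d o i I r (a + (R.actProj id ρ).cls) (.par P R) (.par Q R) where
  outProj := by simp [h.outProj]
  occs x := by simp [h.occs]
  mem := by simp [h.mem]
  self := by simp [h.self, add_right_comm]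
  other j hj := by simp [h.other j hj, add_right_comm]

theorem plus (T : Summ Id Label Cond) {S S' : Summ Id Label Cond}
    (h : Effect ρ id f d o i I r a (.sum S) (.sum S')) :
    Effect ρ id f d o i I r (a + (T.actProj id ρ).cls) (.sum (.plus S T)) (.sum (.plus S' T)) where
  outProj := by
    have e := h.outProj
    simp only [Proto.outProj_sum, Summ.outProj] at e ⊢
    exact Reaction.cls_plus_congr e rfl
  occs x := by
    have e := h.occs x
    simp only [Proto.occs] at e
    simp [e]
  mem := by
    have e := h.mem
    simp only [Proto.occs] at e
    simp [e]
  self := by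
    have e := h.self
    simp only [Proto.actProj] at e
    simp [e, add_right_comm]
  other j hj := by
    have e := h.other j hj
    simp only [Proto.actProj] at e
    simp [e, add_right_comm]

theorem struct {P' Q' : Proto Id Label Cond} (e : SCong P P') (hG : P.Guarded) (hR : P.Regular)
    (h : Effect ρ id f d o i I r a P' Q') (e' : SCong Q' Q) (hG' : Q'.Guarded) (hR' : Q'.Regular) :
    Effect ρ id f d o i I r a P Q where
  outProj := by rw [← e'.outProj_cls hG', h.outProj, e.outProj_cls hG]
  occs x := by rw [← e'.mem_occs_iff hG', h.occs, e.mem_occs_iff hG]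
  mem := (e.mem_occs_iff hG _ _).2 h.mem
  self := by rw [← e'.actProj_cls hG' hR', h.self]
  other j hj := by rw [← e'.actProj_cls hG' hR', h.other j hj, e.actProj_cls hG hR]

theorem of_scong {P' : Proto Id Label Cond} (e : SCong P P') (hG : P.Guarded) (hR : P.Regular)
    (h : Effect ρ id f d o i I r a P' Q) : Effect ρ id f d o i I r a P Q where
  outProj := by rw [h.outProj, e.outProj_cls hG]
  occs x := by rw [h.occs, e.mem_occs_iff hG]
  mem := (e.mem_occs_iff hG _ _).2 h.mem
  self := h.self
  other j hj := by rw [h.other j hj, e.actProj_cls hG hR]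

end Effect

/-- The contraction of a redex is matched by an output of the enabling node. -/
theorem ActStep.effect {M : Model.{u, v, w} Id Label} {P Q : Proto Id Label M.Cond} {id : Id}
    {f : Label} {d : Dir} {o i : M.Cond} {I : List Id} (h : ActStep id f d o i I P Q)
    (hI : I.Nodup) (hG : P.Guarded) (hR : P.Regular) (ρ : ℕ → Reaction Label M.Cond) :
    ∃ r D, DStep M (P.actProj id ρ).toDefn (.out o f d) D ∧
      Effect ρ id f d o i I r D.cls P Q := by
  induction h with
  | base P S =>
    -- The enabled choice becomes `nil`, and what remains of the behaviour of `id` is the activity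
    -- inside the summation.
    refine ⟨(P.outProj ρ).cls,
      .par ((Proto.sum ((Summ.pre f d o i P).plusOpt S)).actProj id ρ).toDefn .nil, ?_, ?_⟩
    swap
    · rw [Defn.cls_par, Defn.cls_nil, add_zero]
      exact Effect.base ρ id f d o i hI P S
    have h : DStep M (.choice ((Summ.pre f d o i P).plusOpt S).outProj) (.out o f d) .nil := by
      cases S
      · exact .out _ _ _
      · exact .sum_left (.out _ _ _)
    simpa [Reaction.toDefn] using DStep.int_right h
  | synch f' d' o' i' _ ih =>
    obtain ⟨r, D, h, h'⟩ := ih hG hR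
    exact ⟨r, D, h, h'.pre _ _ _ _⟩
  | act id' _ ih =>
    obtain ⟨r, D, h, h'⟩ := ih hG hR
    by_cases e : id' = id
    · subst e
      refine ⟨r, _, ?_, h'.act_self⟩
      simpa [Reaction.toDefn] using DStep.int_left h
    · exact ⟨r, D, by simpa [e] using h, h'.act_other e⟩
  | sum T _ ih =>
    obtain ⟨r, D, h, h'⟩ := ih hG.1 hR.1
    exact ⟨r, _, .int_left h, h'.plus T⟩
  | par R _ ih =>
    obtain ⟨r, D, h, h'⟩ := ih hG.1 hR.1
    exact ⟨r, _, .int_left h, h'.par R⟩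
  | struct e h e' ih =>
    have hG' := e.guarded_iff.1 hG
    have hR' := e.regular_iff.1 hR
    obtain ⟨r, D, hD, h'⟩ := ih hG' hR'
    -- The output is found for the congruent protocol and carried over by bisimulation. `Effect`
    -- only sees the class of the residual, which does not change.
    obtain ⟨D', hD', eD⟩ := hD.of_cls_eq M (e.actProj_cls hG hR id ρ).symm
    exact ⟨r, D', hD', eD ▸ .struct e hG hR h' e' (h.guarded hG') (h.regular hR')⟩

end ActSteps

/-! ### Outputs of active nodes come from redexes -/

section Redexes

variable {Id : Type u} {Label : Type v} {Cond : Type w}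

/-- The number of recursions that are not below an action. -/
def Proto.muCount : Proto Id Label Cond → ℕ
  | .nil => 0
  | .par P Q => P.muCount + Q.muCount
  | .mu P => P.muCount + 1
  | .var _ => 0
  | .sum _ => 0
  | .act _ P => P.muCount

mutual
  /-- The number of operators. -/
  def Proto.size : Proto Id Label Cond → ℕ
    | .nil => 0
    | .par P Q => P.size + Q.size + 1
    | .mu P => P.size + 1
    | .var _ => 0
    | .sum S => S.size
    | .act _ P => P.size + 1
  /-- The number of operators. -/
  def Summ.size : Summ Id Label Cond → ℕ
    | .pre _ _ _ _ P => P.size + 1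
    | .plus S T => S.size + T.size + 1
end

attribute [simp] Proto.muCount Proto.size Summ.size

/-- Substitutes for guarded variables land below actions, where recursions are not counted. So only
the unguarded variables need to be sent to variables. -/
theorem Proto.muCount_subst {P : Proto Id Label Cond} : ∀ {τ : ℕ → Proto Id Label Cond},
    (∀ n, ¬ P.VarGuarded n → ∃ m, τ n = .var m) → (P.subst τ).muCount = P.muCount := by
  induction P using Proto.induct with
  | mu P hP =>
    intro τ h
    simp only [Proto.subst_mu, Proto.muCount, add_left_inj]
    refine hP ?_
    rintro (_ | n) hn
    · exact ⟨0, rfl⟩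
    · obtain ⟨m, e⟩ := h n hn
      exact ⟨m + 1, by simp [e]⟩
  | par P Q hP hQ =>
    intro τ h
    simp [hP fun n hn => h n fun h => hn h.1, hQ fun n hn => h n fun h => hn h.2]
  | var n =>
    intro τ h
    obtain ⟨m, e⟩ := h n (by simp)
    simp [e]
  | act id P hP => intro τ h; exact hP h
  | _ => simp

theorem Proto.muCount_unfold {P : Proto Id Label Cond} (h : P.VarGuarded 0) :
    P.unfold.muCount = P.muCount := by
  refine Proto.muCount_subst ?_
  rintro (_ | n) hn
  · exact absurd h hn
  · exact ⟨n, rfl⟩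

theorem Proto.size_subst {P : Proto Id Label Cond} : ∀ {τ : ℕ → Proto Id Label Cond},
    (∀ n, P.Free n → ∃ m, τ n = .var m) → (P.subst τ).size = P.size := by
  induction P using Proto.induct with
  | nil => simp
  | mu P hP => intro τ h; simp [hP (Proto.lift_isVar h)]
  | par P Q hP hQ =>
    intro τ h
    simp [hP fun n hn => h n (.inl hn), hQ fun n hn => h n (.inr hn)]
  | var n =>
    intro τ h
    obtain ⟨m, e⟩ := h n rfl
    simp [e]
  | act id P hP => intro τ h; simp [hP h]
  | pre f d o i P hP => intro τ h; simp [hP h]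
  | plus S T hS hT =>
    intro τ h
    simp only [Proto.subst_sum, Proto.size] at hS hT
    simp [hS fun n hn => h n (.inl hn), hT fun n hn => h n (.inr hn)]

theorem not_dstep_of_cls_eq_zero {M : Model.{u, v, w} Id Label} {D D' : Defn Label M.Cond} {α}
    (e : D.cls = 0) (h : DStep M D α D') : False := by
  obtain ⟨E, h, -⟩ := h.of_cls_eq M (E := .nil) e
  cases h

/-- Associativity and commutativity of `+` bring the summand that fires to the front, which is the
shape that the axioms of reduction require. -/
theorem Summ.exists_summand {M : Model.{u, v, w} Id Label} {o : M.Cond} {f d D} :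
    ∀ (S : Summ Id Label M.Cond), DStep M (.choice S.outProj) (.out o f d) D →
      D = .nil ∧ ∃ i P T, SCong (.sum S) (.sum ((Summ.pre f d o i P).plusOpt T))
  | .pre f' d' o' i' P, h => by
      cases h
      exact ⟨rfl, i', P, none, .refl _⟩
  | .plus S T, h => by
      rw [Summ.outProj, DStep.choice_plus_iff] at h
      rcases h with h | h
      · obtain ⟨e, i, P, U, h⟩ := S.exists_summand h
        refine ⟨e, i, P, ?_⟩
        have h := SCong.plus_congr h (.refl (.sum T))
        cases U with
        | none => exact ⟨some T, h⟩
        | some U => exact ⟨some (.plus U T), h.trans (.symm (.plus_assoc _ _ _))⟩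
      · obtain ⟨e, i, P, U, h⟩ := T.exists_summand h
        refine ⟨e, i, P, ?_⟩
        have h := (SCong.plus_comm S T).trans (SCong.plus_congr h (.refl (.sum S)))
        cases U with
        | none => exact ⟨some S, h⟩
        | some U => exact ⟨some (.plus U S), h.trans (.symm (.plus_assoc _ _ _))⟩

variable [DecidableEq Id]

/-- Congruence pushes `(id)` inwards, past parallel composition, other active nodes and recursion,
until it meets the summation that fires. Unfolding is not structurally smaller, but for guarded
recursion it lowers `muCount` by one; hence an outer induction on a bound `k` and an inner one on
the protocol. -/
theorem exists_actStep_of_outProj {M : Model.{u, v, w} Id Label} (id : Id) {o : M.Cond} {f d}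
    (k : ℕ) (P : Proto Id Label M.Cond) : ∀ {D}, P.muCount < k → P.Guarded → P.Regular →
      DStep M (P.outProj fun _ => .nil).toDefn (.out o f d) D →
        -- The condition `i` and the continuation `r` come before `I`: in a broadcast, the list of
        -- receivers is selected by means of `i`.
        ∃ i r, ∀ I : List Id, I.Nodup → ∃ Q, ActStep id f d o i I (.act id P) Q ∧
          Effect (fun _ => .nil) id f d o i I r
            ((P.actProj id fun _ => .nil).cls + D.cls) (.act id P) Q := by
  induction k generalizing P with
  | zero => intro D h; exact absurd h (Nat.not_lt_zero _)
  | succ k ihk =>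
    induction P using Proto.induct with
    | nil => intro D _ _ _ h; simp only [Proto.outProj_nil, Reaction.toDefn] at h; cases h
    | var n => intro D _ _ _ h; simp only [Proto.outProj_var, Reaction.toDefn] at h; cases h
    | par P₁ P₂ ih₁ ih₂ =>
      intro D hk hG hR h
      simp only [Proto.muCount] at hk
      simp only [Proto.outProj_par, Reaction.toDefn] at h
      cases h with
      | int_left h =>
        obtain ⟨i, r, H⟩ := ih₁ (by omega) hG.1 hR.1 h
        refine ⟨i, r, fun I hI => ?_⟩
        obtain ⟨Q, hQ, hE⟩ := H I hI
        refine ⟨_, .of_scong (.act_par _ _ _) (.par _ hQ), ?_⟩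
        refine .of_scong (.act_par _ _ _) hG hR ?_
        convert hE.par (.act id P₂) using 1
        simp only [Proto.actProj, if_true, Reaction.cls_par, Defn.cls_par, Reaction.cls_toDefn]
        abel
      | int_right h =>
        obtain ⟨i, r, H⟩ := ih₂ (by omega) hG.2 hR.2 h
        refine ⟨i, r, fun I hI => ?_⟩
        obtain ⟨Q, hQ, hE⟩ := H I hI
        have e : SCong (.act id (.par P₁ P₂)) (.par (.act id P₂) (.act id P₁)) :=
          .trans (.act_par _ _ _) (.par_comm _ _)
        refine ⟨_, .of_scong e (.par _ hQ), .of_scong e hG hR ?_⟩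
        convert hE.par (.act id P₁) using 1
        simp only [Proto.actProj, if_true, Reaction.cls_par, Defn.cls_par, Reaction.cls_toDefn]
        abel
    | mu P _ =>
      intro D hk hG hR h
      simp only [Proto.muCount] at hk
      have e : SCong (.act id (.mu P)) (.act id P.unfold) := .act_congr _ (.mu_unfold P)
      rw [← P.outProj_unfold hG.1] at h
      -- Only the outer hypothesis applies to the unfolding. Guardedness gives it the `muCount` of
      -- the body, one less than that of the recursion.
      obtain ⟨i, r, H⟩ := ihk P.unfold (by rw [Proto.muCount_unfold hG.1]; omega)
        (P.guarded_unfold.2 hG) (P.regular_unfold.2 hR) h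
      refine ⟨i, r, fun I hI => ?_⟩
      obtain ⟨Q, hQ, hE⟩ := H I hI
      rw [Proto.actProj_unfold_cls id hG.1 hR.2] at hE
      exact ⟨Q, .of_scong e hQ, .of_scong e hG hR hE⟩
    | act id' P ih =>
      intro D hk hG hR h
      rw [Proto.outProj_act] at h
      obtain ⟨i, r, H⟩ := ih hk hG hR h
      refine ⟨i, r, fun I hI => ?_⟩
      obtain ⟨Q, hQ, hE⟩ := H I hI
      have e : SCong (.act id (.act id' P)) (.act id' (.act id P)) := .act_act _ _ _
      refine ⟨_, .of_scong e (.act id' hQ), .of_scong e hG hR ?_⟩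
      by_cases hid : id' = id
      · subst hid
        convert hE.act_self using 1
        simp only [Proto.actProj, if_true, Reaction.cls_par, Proto.outProj_act]
        abel
      · simpa [hid] using hE.act_other hid
    | pre | plus =>
      intro D _ hG hR h
      rw [Proto.outProj_sum] at h
      obtain ⟨rfl, i, P, T, e⟩ := Summ.exists_summand _ h
      have e' := SCong.act_congr id e
      refine ⟨i, (P.outProj fun _ => .nil).cls, fun I hI => ?_⟩
      refine ⟨_, .of_scong e' (.base P T), .of_scong e' hG hR ?_⟩
      rw [e.actProj_cls hG hR, Defn.cls_nil, add_zero]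
      exact Effect.base _ id f d o i hI P T

/-- Activity may lie below actions, so the induction descends through continuations. In a regular
recursion an output can arise only if the variable does not occur; then unfolding just drops the
binder and `size` decreases. -/
theorem exists_actStep_of_actProj {M : Model.{u, v, w} Id Label} (id : Id) {o : M.Cond} {f d}
    (k : ℕ) : ∀ (P : Proto Id Label M.Cond) {D}, P.size < k → P.Guarded → P.Regular →
      DStep M (P.actProj id fun _ => .nil).toDefn (.out o f d) D →
        ∃ i r, ∀ I : List Id, I.Nodup → ∃ Q, ActStep id f d o i I P Q ∧
          Effect (fun _ => .nil) id f d o i I r D.cls P Q ∧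
          -- Contraction inside a summation yields a summation again. Without this clause
          -- `ActStep.sum` could not be applied to the result of the induction hypothesis.
          ((∃ S, P = .sum S) → ∃ S, Q = .sum S) := by
  induction k with
  | zero => intro P D h; exact absurd h (Nat.not_lt_zero _)
  | succ k ihk =>
    intro P D hk hG hR h
    rcases P with _ | ⟨P₁, P₂⟩ | P | n | (⟨f', d', o', i', P⟩ | ⟨S, T⟩) | ⟨id', P⟩
    · simp only [Proto.actProj, Reaction.toDefn] at h; cases h
    · simp only [Proto.size] at hk
      simp only [Proto.actProj, Reaction.toDefn] at h
      cases h with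
      | int_left h =>
        obtain ⟨i, r, H⟩ := ihk P₁ (by omega) hG.1 hR.1 h
        refine ⟨i, r, fun I hI => ?_⟩
        obtain ⟨Q, hQ, hE, -⟩ := H I hI
        exact ⟨_, .par P₂ hQ, hE.par P₂, by simp⟩
      | int_right h =>
        obtain ⟨i, r, H⟩ := ihk P₂ (by omega) hG.2 hR.2 h
        refine ⟨i, r, fun I hI => ?_⟩
        obtain ⟨Q, hQ, hE, -⟩ := H I hI
        refine ⟨_, .of_scong (.par_comm _ _) (.par P₁ hQ), ?_, by simp⟩
        refine .of_scong (.par_comm _ _) hG hR ?_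
        convert hE.par P₁ using 1
        simp [add_comm]
    · simp only [Proto.size] at hk
      by_cases h0 : P.Free 0
      -- By regularity the active projection is congruent to `nil`, so there is no output to
      -- explain.
      · exact (not_dstep_of_cls_eq_zero
          (Proto.VoidActs.actProj_cls (P := .mu P) id (hR.2 h0) _) h).elim
      · obtain ⟨D', h, e⟩ := h.of_cls_eq M (Proto.actProj_unfold_cls id hG.1 hR.2 _).symm
        obtain ⟨i, r, H⟩ := ihk P.unfold
          (by rw [Proto.unfold, Proto.size_subst (Proto.unfold_isVar h0)]; omega)
          (P.guarded_unfold.2 hG) (P.regular_unfold.2 hR) h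
        refine ⟨i, r, fun I hI => ?_⟩
        obtain ⟨Q, hQ, hE, -⟩ := H I hI
        exact ⟨_, .of_scong (.mu_unfold P) hQ, e ▸ .of_scong (.mu_unfold P) hG hR hE, by simp⟩
    · simp only [Proto.actProj, Reaction.toDefn] at h; cases h
    · simp only [Proto.size, Summ.size] at hk
      obtain ⟨i, r, H⟩ := ihk P (by omega) hG hR h
      refine ⟨i, r, fun I hI => ?_⟩
      obtain ⟨Q, hQ, hE, -⟩ := H I hI
      exact ⟨_, .synch _ _ _ _ hQ, hE.pre _ _ _ _, fun _ => ⟨_, rfl⟩⟩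
    · simp only [Proto.size, Summ.size] at hk
      simp only [Proto.actProj, Summ.actProj, Reaction.toDefn] at h
      cases h with
      | int_left h =>
        obtain ⟨i, r, H⟩ := ihk (.sum S) (by simp only [Proto.size]; omega) hG.1 hR.1 h
        refine ⟨i, r, fun I hI => ?_⟩
        obtain ⟨Q, hQ, hE, hS⟩ := H I hI
        obtain ⟨S', rfl⟩ := hS ⟨S, rfl⟩
        exact ⟨_, .sum T hQ, hE.plus T, fun _ => ⟨_, rfl⟩⟩
      | int_right h =>
        obtain ⟨i, r, H⟩ := ihk (.sum T) (by simp only [Proto.size]; omega) hG.2 hR.2 h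
        refine ⟨i, r, fun I hI => ?_⟩
        obtain ⟨Q, hQ, hE, hS⟩ := H I hI
        obtain ⟨T', rfl⟩ := hS ⟨T, rfl⟩
        refine ⟨_, .of_scong (.plus_comm _ _) (.sum S hQ), ?_, fun _ => ⟨_, rfl⟩⟩
        refine .of_scong (.plus_comm _ _) hG hR ?_
        convert hE.plus S using 1
        simp [add_comm]
    · simp only [Proto.size] at hk
      by_cases e : id' = id
      · subst e
        simp only [Proto.actProj, if_true, Reaction.toDefn] at h
        cases h with
        | int_left h =>
          obtain ⟨i, r, H⟩ := ihk P (by omega) hG hR h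
          refine ⟨i, r, fun I hI => ?_⟩
          obtain ⟨Q, hQ, hE, -⟩ := H I hI
          exact ⟨_, .act _ hQ, hE.act_self, by simp⟩
        | int_right h =>
          obtain ⟨i, r, H⟩ := exists_actStep_of_outProj id' _ P (Nat.lt_succ_self _) hG hR h
          refine ⟨i, r, fun I hI => ?_⟩
          obtain ⟨Q, hQ, hE⟩ := H I hI
          exact ⟨Q, hQ, hE, by simp⟩
      · simp only [Proto.actProj, if_neg e] at h
        obtain ⟨i, r, H⟩ := ihk P (by omega) hG hR h
        refine ⟨i, r, fun I hI => ?_⟩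
        obtain ⟨Q, hQ, hE, -⟩ := H I hI
        exact ⟨_, .act _ hQ, hE.act_other e, by simp⟩

end Redexes

/-! ### Transitions of parallel compositions of nodes -/

section Networks

variable {Id : Type u} {Label : Type v} {Cond : Type w}

theorem Network.ofList_cons (N : Network Id Label Cond) {L : List (Network Id Label Cond)}
    (hL : L ≠ []) (h : N :: L ≠ []) : Network.ofList (N :: L) h = .par N (Network.ofList L hL) := by
  cases L with
  | nil => exact absurd rfl hL
  | cons N' L => rw [Network.ofList]

theorem Network.ofList_congr {L L' : List (Network Id Label Cond)} (e : L = L') (h : L ≠ [])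
    (h' : L' ≠ []) : Network.ofList L h = Network.ofList L' h' := by
  subst e
  rfl

/-- The projection lists the nodes in an arbitrary order, which an update of the network state may
change. -/
theorem NCong.ofList_perm {L L' : List (Network Id Label Cond)} (p : L.Perm L') (h : L ≠ [])
    (h' : L' ≠ []) : NCong (Network.ofList L h) (Network.ofList L' h') := by
  induction p with
  | nil => exact absurd rfl h
  | @cons N L L' p ih =>
    by_cases hL : L = []
    · subst hL
      obtain rfl := List.nil_perm.1 p
      exact .refl _
    · have hL' : L' ≠ [] := fun e => hL (List.perm_nil.1 (e ▸ p))
      rw [Network.ofList_cons N hL, Network.ofList_cons N hL']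
      exact .par_congr (.refl _) (ih hL hL')
  | swap N K L =>
    by_cases hL : L = []
    · subst hL
      exact .par_comm _ _
    · rw [Network.ofList_cons K (by simp), Network.ofList_cons N hL, Network.ofList_cons N (by simp),
        Network.ofList_cons K hL]
      exact (NCong.par_assoc _ _ _).trans
        ((NCong.par_congr (.par_comm _ _) (.refl _)).trans (.symm (.par_assoc _ _ _)))
  | @trans L₁ L₂ L₃ p _ ih ih' =>
    have hL : L₂ ≠ [] := fun e => h (List.perm_nil.1 (e ▸ p))
    exact (ih h hL).trans (ih' hL h')

theorem NCong.ofList_map {ι : Type*} {g g' : ι → Network Id Label Cond} (E : List ι)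
    (H : ∀ e ∈ E, NCong (g e) (g' e)) (h : E.map g ≠ []) (h' : E.map g' ≠ []) :
    NCong (Network.ofList (E.map g) h) (Network.ofList (E.map g') h') := by
  induction E with
  | nil => exact absurd rfl h
  | cons a E ih =>
    cases E with
    | nil => exact H a (by simp)
    | cons b E =>
      exact .par_congr (H a (by simp)) (ih (fun e he => H e (List.mem_cons_of_mem _ he)) (by simp)
        (by simp))

-- Transitions of a parallel composition, described by its components.

variable (M : Model.{u, v, w} Id Label)

/-- The components of a parallel composition that take part in a transition, and how they change. -/
def ListStep {ι : Type*} (E : List ι) (g g' : ι → Network Id Label M.Cond) :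
    NLabel Id Label → Prop
  | .tau => (∃ a ∈ E, NStep M (g a) .tau (g' a) ∧ ∀ e ∈ E, e ≠ a → g' e = g e) ∨
      ∃ a ∈ E, ∃ b ∈ E, a ≠ b ∧ ∃ i j f, NStep M (g a) (.send i j f) (g' a) ∧
        NStep M (g b) (.recv j i f) (g' b) ∧ ∀ e ∈ E, e ≠ a → e ≠ b → g' e = g e
  | .send i j f => ∃ a ∈ E, NStep M (g a) (.send i j f) (g' a) ∧ ∀ e ∈ E, e ≠ a → g' e = g e
  | .recv i j f => ∃ a ∈ E, NStep M (g a) (.recv i j f) (g' a) ∧ ∀ e ∈ E, e ≠ a → g' e = g e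
  | .bsend i f => ∃ a ∈ E, NStep M (g a) (.bsend i f) (g' a) ∧
      ∀ e ∈ E, e ≠ a → NStep M (g e) (.brecv i f) (g' e)
  | .brecv i f => ∀ e ∈ E, NStep M (g e) (.brecv i f) (g' e)

variable {M} {ι : Type*} {g g' : ι → Network Id Label M.Cond} {l : NLabel Id Label}

theorem ListStep.congr {E : List ι} {g'' : ι → Network Id Label M.Cond}
    (H : ∀ e ∈ E, g' e = g'' e) (h : ListStep M E g g' l) : ListStep M E g g'' l := by
  cases l with
  | tau =>
    rcases h with ⟨a, ha, h, h'⟩ | ⟨a, ha, b, hb, hne, i, j, f, h, h', h''⟩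
    · exact .inl ⟨a, ha, H a ha ▸ h, fun e he hne => H e he ▸ h' e he hne⟩
    · exact .inr ⟨a, ha, b, hb, hne, i, j, f, H a ha ▸ h, H b hb ▸ h',
        fun e he h₁ h₂ => H e he ▸ h'' e he h₁ h₂⟩
  | send | recv | bsend =>
    obtain ⟨a, ha, h, h'⟩ := h
    exact ⟨a, ha, H a ha ▸ h, fun e he hne => H e he ▸ h' e he hne⟩
  | brecv => exact fun e he => H e he ▸ h e he

theorem ListStep.cons_of_head {a : ι} {E : List ι} (h : NStep M (g a) l (g' a))
    (hl : ¬ l.IsBroadcast) (h' : ∀ e ∈ E, g' e = g e) : ListStep M (a :: E) g g' l := by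
  have H : ∀ e ∈ a :: E, e ≠ a → g' e = g e := fun e he hne =>
    h' e ((List.mem_cons.1 he).resolve_left hne)
  cases l with
  | tau => exact .inl ⟨a, by simp, h, H⟩
  | send | recv => exact ⟨a, by simp, h, H⟩
  | bsend | brecv => exact absurd trivial hl

theorem ListStep.cons_of_tail {a : ι} {E : List ι} (h : ListStep M E g g' l)
    (hl : ¬ l.IsBroadcast) (h' : g' a = g a) : ListStep M (a :: E) g g' l := by
  have H : ∀ {p : ι → Prop}, (∀ e ∈ E, p e → g' e = g e) → ∀ e ∈ a :: E, p e → g' e = g e := by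
    intro p hp e he hpe
    rcases List.mem_cons.1 he with rfl | he
    · exact h'
    · exact hp e he hpe
  cases l with
  | tau =>
    rcases h with ⟨b, hb, h, h'⟩ | ⟨b, hb, c, hc, hne, i, j, f, h₁, h₂, h₃⟩
    · exact .inl ⟨b, by simp [hb], h, H h'⟩
    · refine .inr ⟨b, by simp [hb], c, by simp [hc], hne, i, j, f, h₁, h₂, fun e he hb hc => ?_⟩
      exact H (p := fun e => e ≠ b ∧ e ≠ c) (fun e he h => h₃ e he h.1 h.2) e he ⟨hb, hc⟩
  | send | recv =>
    obtain ⟨b, hb, h, h'⟩ := h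
    exact ⟨b, by simp [hb], h, H h'⟩
  | bsend | brecv => exact absurd trivial hl

/-- The side condition `a ∉ E` makes the two partners of a synchronisation distinct indices. -/
theorem ListStep.cons_com {a : ι} {E : List ι} {l₁ l₂ : NLabel Id Label} (ha : a ∉ E)
    (h : NStep M (g a) l₁ (g' a)) (h' : ListStep M E g g' l₂) (hl : Gamma l₁ l₂ l) :
    ListStep M (a :: E) g g' l := by
  have hne : ∀ {b}, b ∈ E → b ≠ a := fun hb e => ha (e ▸ hb)
  cases hl with
  | send_recv i j f =>
    obtain ⟨b, hb, h', H⟩ := h'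
    refine .inr ⟨a, by simp, b, by simp [hb], (hne hb).symm, i, j, f, h, h', ?_⟩
    exact fun e he h₁ h₂ => H e ((List.mem_cons.1 he).resolve_left h₁) h₂
  | recv_send i j f =>
    obtain ⟨b, hb, h', H⟩ := h'
    refine .inr ⟨b, by simp [hb], a, by simp, hne hb, j, i, f, h', h, ?_⟩
    exact fun e he h₁ h₂ => H e ((List.mem_cons.1 he).resolve_left h₂) h₁
  | bsend_brecv i f =>
    exact ⟨a, by simp, h, fun e he hne => h' e ((List.mem_cons.1 he).resolve_left hne)⟩
  | brecv_bsend i f =>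
    obtain ⟨b, hb, h', H⟩ := h'
    refine ⟨b, by simp [hb], h', fun e he hne => ?_⟩
    rcases List.mem_cons.1 he with rfl | he
    · exact h
    · exact H e he hne
  | brecv_brecv i f =>
    intro e he
    rcases List.mem_cons.1 he with rfl | he
    · exact h
    · exact h' e he

theorem ListStep.singleton {a : ι} (h : NStep M (g a) l (g' a)) : ListStep M [a] g g' l := by
  cases l with
  | tau => exact .inl ⟨a, by simp, h, by simp⟩
  | send | recv | bsend => exact ⟨a, by simp, h, by simp⟩
  | brecv => simpa [ListStep] using h

/-- Inversion of the transitions of a parallel composition. -/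
theorem NStep.exists_listStep [DecidableEq ι] {E : List ι} (hE : E.Nodup) : ∀ {l N}
    {h₀ : E.map g ≠ []}, NStep M (Network.ofList (E.map g) h₀) l N →
      ∃ (g' : ι → Network Id Label M.Cond) (h₁ : E.map g' ≠ []),
        N = Network.ofList (E.map g') h₁ ∧ ListStep M E g g' l := by
  induction E with
  | nil => intro l N h₀; exact absurd rfl h₀
  | cons a E ih =>
    intro l N h₀ h
    cases E with
    | nil => exact ⟨fun _ => N, by simp, rfl, .singleton h⟩
    | cons b E =>
      obtain ⟨ha, hE⟩ := List.nodup_cons.1 hE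
      -- The head does not recur in the tail, so the family of residuals obtained for the tail can
      -- be overwritten at the head without being disturbed elsewhere.
      have key : ∀ (g'' : ι → Network Id Label M.Cond) (N : Network Id Label M.Cond),
          ∀ e ∈ b :: E, g'' e = Function.update g'' a N e := by
        intro g'' N e he
        rw [Function.update_of_ne]
        rintro rfl
        exact ha he
      have fin : ∀ (g'' : ι → Network Id Label M.Cond) (N : Network Id Label M.Cond)
          (h₁ : (b :: E).map g'' ≠ []),
          (Network.par N (.ofList ((b :: E).map g'') h₁)) =
            .ofList ((a :: b :: E).map (Function.update g'' a N)) (by simp) := by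
        intro g'' N h₁
        change _ = Network.par (Function.update g'' a N a)
          (.ofList ((b :: E).map (Function.update g'' a N)) (by simp))
        rw [Function.update_self, Network.ofList_congr (List.map_congr_left (key g'' N)) _ _]
      rw [Network.ofList_congr (List.map_cons ..) _ (by simp),
        Network.ofList_cons (g a) (by simp)] at h
      cases h with
      | com h h' hl =>
        obtain ⟨g'', h₁, rfl, ht⟩ := ih hE h'
        refine ⟨Function.update g'' a _, by simp, fin g'' _ h₁, ?_⟩
        exact .cons_com ha (by rwa [Function.update_self]) (ht.congr (key g'' _)) hl
      | par_left h hl =>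
        refine ⟨Function.update g a _, by simp, fin g _ (by simp), ?_⟩
        exact .cons_of_head (by rwa [Function.update_self]) hl fun e he => (key g _ e he).symm
      | par_right h' hl =>
        obtain ⟨g'', h₁, rfl, ht⟩ := ih hE h'
        refine ⟨Function.update g'' a (g a), by simp, fin g'' _ h₁, ?_⟩
        exact .cons_of_tail (ht.congr (key g'' _)) hl (by rw [Function.update_self])

/-- Transitions of components give transitions of the parallel composition. -/
theorem ListStep.nstep {E : List ι} (hE : E.Nodup) : ∀ {l} {h₀ : E.map g ≠ []} {h₁ : E.map g' ≠ []},
    ListStep M E g g' l → NStep M (Network.ofList (E.map g) h₀) l (Network.ofList (E.map g') h₁) := by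
  induction E with
  | nil => intro l h₀; exact absurd rfl h₀
  | cons a E ih =>
    intro l h₀ h₁ h
    cases E with
    | nil =>
      change NStep M (g a) l (g' a)
      cases l with
      | tau =>
        rcases h with ⟨b, hb, h, -⟩ | ⟨b, hb, c, hc, hne, -⟩
        · rwa [List.mem_singleton.1 hb] at h
        · exact absurd ((List.mem_singleton.1 hb).trans (List.mem_singleton.1 hc).symm) hne
      | send | recv | bsend =>
        obtain ⟨b, hb, h, -⟩ := h
        rwa [List.mem_singleton.1 hb] at h
      | brecv => exact h a (by simp)
    | cons b E =>
      obtain ⟨ha, hE⟩ := List.nodup_cons.1 hE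
      have hne : ∀ {e}, e ∈ b :: E → e ≠ a := fun he h => ha (h ▸ he)
      have ih := fun l => ih hE (l := l) (h₀ := by simp) (h₁ := by simp)
      have same : (∀ e ∈ b :: E, g' e = g e) →
          Network.ofList ((b :: E).map g') (by simp) = Network.ofList ((b :: E).map g) (by simp) :=
        fun H => Network.ofList_congr (List.map_congr_left H) _ _
      rw [Network.ofList_congr (List.map_cons ..) _ (by simp), Network.ofList_cons (g a) (by simp),
        Network.ofList_congr (List.map_cons ..) h₁ (by simp), Network.ofList_cons (g' a) (by simp)]
      cases l with
      | tau =>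
        rcases h with ⟨c, hc, h, H⟩ | ⟨c, hc', d, hd', hcd, i, j, f, h, h', H⟩
        · rcases List.mem_cons.1 hc with rfl | hc
          · rw [same fun e he => H e (List.mem_cons_of_mem _ he) (hne he)]
            -- `id` proves that `τ` is not a broadcast label, because `IsBroadcast` reduces to
            -- `False` there.
            exact .par_left h id
          · rw [H a (by simp) (hne hc).symm]
            exact .par_right (ih .tau
              (.inl ⟨c, hc, h, fun e he => H e (List.mem_cons_of_mem _ he)⟩)) id
        · rcases List.mem_cons.1 hc' with rfl | hc
          · rcases List.mem_cons.1 hd' with rfl | hd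
            · exact absurd rfl hcd
            · exact .com h (ih (.recv j i f) ⟨d, hd, h', fun e he =>
                H e (List.mem_cons_of_mem _ he) (hne he)⟩) (.send_recv i j f)
          · rcases List.mem_cons.1 hd' with rfl | hd
            · exact .com h' (ih (.send i j f) ⟨c, hc, h, fun e he h₁ =>
                H e (List.mem_cons_of_mem _ he) h₁ (hne he)⟩) (.recv_send j i f)
            · rw [H a (by simp) (hne hc).symm (hne hd).symm]
              exact .par_right (ih .tau (.inr ⟨c, hc, d, hd, hcd, i, j, f, h, h', fun e he =>
                H e (List.mem_cons_of_mem _ he)⟩)) id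
      | send i j f | recv i j f =>
        obtain ⟨c, hc, h, H⟩ := h
        rcases List.mem_cons.1 hc with rfl | hc
        · rw [same fun e he => H e (List.mem_cons_of_mem _ he) (hne he)]
          exact .par_left h id
        · rw [H a (by simp) (hne hc).symm]
          exact .par_right (ih _ ⟨c, hc, h, fun e he => H e (List.mem_cons_of_mem _ he)⟩) id
      | bsend i f =>
        obtain ⟨c, hc, h, H⟩ := h
        rcases List.mem_cons.1 hc with rfl | hc
        · exact .com h (ih (.brecv i f) fun e he => H e (List.mem_cons_of_mem _ he) (hne he))
            (.bsend_brecv i f)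
        · exact .com (H a (by simp) (hne hc).symm)
            (ih (.bsend i f) ⟨c, hc, h, fun e he => H e (List.mem_cons_of_mem _ he)⟩)
            (.brecv_bsend i f)
      | brecv i f =>
        exact .com (h a (by simp)) (ih (.brecv i f) fun e he => h e (List.mem_cons_of_mem _ he))
          (.brecv_brecv i f)

/-! #### Transitions of nodes -/

theorem NStep.node_send {s : State Id} {D D' : Defn Label M.Cond} {c f d j} (hd : BinTarget d s j)
    (h : DStep M D (.out c f d) D') (hc : M.Sat s c) :
    NStep M (.node s D) (.send s.self j f) (.node (M.effOut f d s j) D') := by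
  cases d with
  | star => exact hd.elim
  | self => exact hd.elim
  | up => cases hd; exact .oBinU h hc
  | right => exact .oBinR h hc hd

theorem BinTarget.up_or_right {d : Dir} {s : State Id} {j : Id} (h : BinTarget d s j) :
    d = .up ∨ d = .right := by
  cases d <;> simp_all [BinTarget]

theorem NStep.node_tau_inv {s : State Id} {D : Defn Label M.Cond} {N}
    (h : NStep M (.node s D) .tau N) :
    ∃ c f D', DStep M D (.loc c f) D' ∧ M.Sat s c ∧ N = .node s D' := by
  cases h with
  | loc h hc => exact ⟨_, _, _, h, hc, rfl⟩

theorem NStep.node_send_inv {s : State Id} {D : Defn Label M.Cond} {i j f N}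
    (h : NStep M (.node s D) (.send i j f) N) :
    s.self = i ∧ ∃ c d D', BinTarget d s j ∧ DStep M D (.out c f d) D' ∧ M.Sat s c ∧
      N = .node (M.effOut f d s j) D' := by
  cases h with
  | oBinU h hc => exact ⟨rfl, _, .up, _, rfl, h, hc, rfl⟩
  | oBinR h hc hj => exact ⟨rfl, _, .right, _, hj, h, hc, rfl⟩

theorem NStep.node_recv_inv {s : State Id} {D : Defn Label M.Cond} {i j f N}
    (h : NStep M (.node s D) (.recv i j f) N) :
    s.self = i ∧ ∃ c d D', DStep M D (.inp c f d) D' ∧ M.Sat s c ∧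
      N = .node (M.effIn f d s j) D' := by
  cases h with
  | iBin _ h hc => exact ⟨rfl, _, _, _, h, hc, rfl⟩

theorem NStep.node_bsend_inv {s : State Id} {D : Defn Label M.Cond} {i f N}
    (h : NStep M (.node s D) (.bsend i f) N) :
    s.self = i ∧ ∃ c D', DStep M D (.out c f .star) D' ∧ M.Sat s c ∧ N = .node s D' := by
  cases h with
  | oBrd h hc => exact ⟨rfl, _, _, h, hc, rfl⟩

theorem NStep.node_brecv_inv {s : State Id} {D : Defn Label M.Cond} {i f N}
    (h : NStep M (.node s D) (.brecv i f) N) :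
    (s.source = i ∧ ∃ c D', DStep M D (.inp c f .star) D' ∧ M.Sat s c ∧ N = .node s D') ∨
      (Discard M s D i f ∧ N = .node s D) := by
  cases h with
  | iBrd h hc => exact .inl ⟨rfl, _, _, h, hc, rfl⟩
  | dBrd h => exact .inr ⟨h, rfl⟩

end Networks

/-! ### Well-formed protocols -/

section WellFormedness

variable {Id : Type u} {Label : Type v} {Cond : Type w}

theorem Proto.Static.voidActs {P : Proto Id Label Cond} (h : P.Static) : P.VoidActs := by
  induction P using Proto.induct <;> simp_all [Proto.Static, Summ.Static]

theorem Proto.TopActive.regular {P : Proto Id Label Cond} (h : P.TopActive) : P.Regular := by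
  induction h with
  | static h => exact h.voidActs.regular
  | act id _ ih => exact ih
  | par _ _ ih ih' => exact ⟨ih, ih'⟩

/-- Hence, if all labels are distinct, an entry of `occs` is determined by its label. This is how
coherence starts. -/
theorem Proto.map_fst_occs (P : Proto Id Label Cond) :
    ∀ ρ : ℕ → Reaction Label Cond, (P.occs ρ).map Prod.fst = P.labels := by
  induction P using Proto.induct <;> simp_all [Proto.labels, Summ.labels]

/-- Actions with the same label have the same direction, the same conditions and congruent
continuations. -/
def Proto.Coherent (P : Proto Id Label Cond) : Prop :=
  ∀ x ∈ P.occs fun _ => .nil, ∀ y ∈ P.occs fun _ => .nil, x.1 = y.1 → x = y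

theorem Proto.coherent_of_labels_nodup {P : Proto Id Label Cond} (h : P.labels.Nodup) :
    P.Coherent := by
  rw [← P.map_fst_occs fun _ => .nil] at h
  exact fun x hx y hy e => List.inj_on_of_nodup_map h hx hy e

theorem Proto.Coherent.of_occs {P Q : Proto Id Label Cond} (h : P.Coherent)
    (e : ∀ x, (x ∈ Q.occs fun _ => .nil) ↔ x ∈ P.occs fun _ => .nil) : Q.Coherent :=
  fun x hx y hy => h x ((e x).1 hx) y ((e y).1 hy)

variable [DecidableEq Id]

/-- In a specification, nodes are active outside recursions only, so it is regular, and distinct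
labels make it coherent. Every reduction and every congruence step leaves the set of actions as it
is and preserves guardedness and regularity. -/
theorem Proto.WellFormed.invariants {M : Model.{u, v, w} Id Label} {P : Proto Id Label M.Cond}
    (h : P.WellFormed M) : P.Guarded ∧ P.Regular ∧ P.Coherent := by
  obtain ⟨Δ₀, Δ₁, P₀, P₁, h₀, h₁, e⟩ := h
  have key : P₁.Guarded ∧ P₁.Regular ∧ P₁.Coherent := by
    have H : ∀ c : NetState Id × Proto Id Label M.Cond,
        Relation.ReflTransGen (fun c c' : NetState Id × Proto Id Label M.Cond =>
          Red M c.1 c.2 c'.1 c'.2) (Δ₀, P₀) c →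
        c.2.Guarded ∧ c.2.Regular ∧ c.2.Coherent := by
      intro c hc
      induction hc with
      | refl =>
        exact ⟨h₀.guarded, h₀.topActive.regular, Proto.coherent_of_labels_nodup h₀.labels_nodup⟩
      | tail _ h ih =>
        obtain ⟨id, f, d, o, i, I, hE, hA⟩ := h.exists_actStep
        obtain ⟨r, D, -, hEff⟩ := hA.effect hE.nodup ih.1 ih.2.1 fun _ => .nil
        exact ⟨hA.guarded ih.1, hA.regular ih.2.1, ih.2.2.of_occs hEff.occs⟩
    exact H _ h₁
  exact ⟨e.guarded_iff.1 key.1, e.regular_iff.1 key.2.1,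
    key.2.2.of_occs fun x => (e.mem_occs_iff key.1 _ x).symm⟩

end WellFormedness

/-! ### The behaviour of nodes -/

section Nodes

variable {Id : Type u} {Label : Type v} {M : Model.{u, v, w} Id Label}

/-- Without inputs there is nothing to react with and nothing to synchronise with internally. -/
theorem Reaction.step_out (R : Reaction Label M.Cond) {α D} (h : DStep M R.toDefn α D) :
    ∃ o f d, α = .out o f d := by
  induction R generalizing α D with
  | nil => simp only [Reaction.toDefn] at h; cases h
  | choice C =>
    simp only [Reaction.toDefn] at h
    -- The source of the transition has to be a variable for the induction on its derivation.
    generalize e : Defn.choice C = E at h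
    induction h generalizing C with
    | out => exact ⟨_, _, _, rfl⟩
    | sum_left _ ih | sum_right _ ih => exact ih _ rfl
    | _ => cases e
  | par R R' ih ih' =>
    simp only [Reaction.toDefn] at h
    cases h with
    | int_left h => exact ih h
    | int_right h => exact ih' h
    | self_left _ h => obtain ⟨_, _, _, e⟩ := ih' h; cases e
    | self_right h _ => obtain ⟨_, _, _, e⟩ := ih h; cases e

variable [DecidableEq Id] {P : Proto Id Label M.Cond} {id : Id}

theorem Proto.nodeProj_cls (P : Proto Id Label M.Cond) (id : Id) :
    (P.nodeProj id).cls =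
      (P.inProj fun _ => .nil).cls + (P.actProj id fun _ => .nil).cls := rfl

theorem Proto.nodeProj_out_inv {o f d D} (h : DStep M (P.nodeProj id) (.out o f d) D) :
    ∃ A, DStep M (P.actProj id fun _ => .nil).toDefn (.out o f d) A ∧
      D.cls = (P.inProj fun _ => .nil).cls + A.cls := by
  rw [Proto.nodeProj] at h
  cases h with
  | int_left h => obtain ⟨_, _, _, _, _, -, e, -⟩ := P.inProj_step M h; cases e
  | int_right h => exact ⟨_, h, rfl⟩

theorem Proto.nodeProj_inp_inv {c f d D} (h : DStep M (P.nodeProj id) (.inp c f d) D) :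
    ∃ o r, ((f, d, o, c, r) ∈ P.occs fun _ => .nil) ∧ D.cls = (P.nodeProj id).cls + r := by
  rw [Proto.nodeProj] at h
  cases h with
  | int_left h =>
    obtain ⟨f, d, o, i, r, hx, e, e'⟩ := P.inProj_step M h
    cases e
    exact ⟨o, r, hx, by rw [Defn.cls_par, e', Proto.nodeProj_cls, add_right_comm]; rfl⟩
  | int_right h => obtain ⟨_, _, _, e⟩ := Reaction.step_out _ h; cases e

/-- The active part can only output and the reactive part can only input, so a local step pairs the
two. Nothing yet relates the enabling condition `o` of the output to the condition `o'` of the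
action behind the input; coherence does so later. -/
theorem Proto.nodeProj_loc_inv {c f D} (h : DStep M (P.nodeProj id) (.loc c f) D) :
    ∃ o o' i r A, c = M.conj o i ∧
      DStep M (P.actProj id fun _ => .nil).toDefn (.out o f .self) A ∧
      ((f, .self, o', i, r) ∈ P.occs fun _ => .nil) ∧
      D.cls = (P.inProj fun _ => .nil).cls + A.cls + r := by
  rw [Proto.nodeProj] at h
  cases h with
  | int_left h => obtain ⟨_, _, _, _, _, -, e, -⟩ := P.inProj_step M h; cases e
  | int_right h => obtain ⟨_, _, _, e⟩ := Reaction.step_out _ h; cases e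
  | self_left h => obtain ⟨_, _, _, _, _, -, e, -⟩ := P.inProj_step M h; cases e
  | self_right h h' =>
    obtain ⟨f, d, o, i, r, hx, e, e'⟩ := P.inProj_step M h
    cases e
    exact ⟨_, o, _, r, _, rfl, h', hx, by rw [Defn.cls_par, e', add_right_comm]⟩

theorem Proto.nodeProj_out {o f d A}
    (h : DStep M (P.actProj id fun _ => .nil).toDefn (.out o f d) A) :
    DStep M (P.nodeProj id) (.out o f d) (.par (P.inProj fun _ => .nil) A) :=
  .int_right h

theorem Proto.nodeProj_inp {f d o i r} (h : (f, d, o, i, r) ∈ P.occs fun _ => .nil) (id : Id) :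
    ∃ D, DStep M (P.nodeProj id) (.inp i f d) D ∧ D.cls = (P.nodeProj id).cls + r := by
  obtain ⟨D, h, e⟩ := P.inProj_can_step M h
  exact ⟨_, .int_left h, by rw [Defn.cls_par, e, Proto.nodeProj_cls, add_right_comm]; rfl⟩

theorem Proto.nodeProj_loc {o o' f i r A}
    (h : DStep M (P.actProj id fun _ => .nil).toDefn (.out o f .self) A)
    (h' : (f, .self, o', i, r) ∈ P.occs fun _ => .nil) :
    ∃ D, DStep M (P.nodeProj id) (.loc (M.conj o i) f) D ∧
      D.cls = (P.inProj fun _ => .nil).cls + A.cls + r := by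
  obtain ⟨D, h', e⟩ := P.inProj_can_step M h'
  exact ⟨_, .self_right h' h, by rw [Defn.cls_par, e, add_right_comm]⟩

variable {f : Label} {d : Dir} {o i : M.Cond} {I : List Id} {r a : DClass Label M.Cond}
  {Q : Proto Id Label M.Cond}

theorem Effect.nodeProj_self (h : Effect (fun _ => .nil) id f d o i I r a P Q) :
    (Q.nodeProj id).cls = (P.inProj fun _ => .nil).cls + a + if id ∈ I then r else 0 := by
  rw [Proto.nodeProj_cls, h.self, Proto.inProj_cls_eq h.occs, add_assoc]

theorem Effect.nodeProj_other (h : Effect (fun _ => .nil) id f d o i I r a P Q) {j : Id}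
    (hj : j ≠ id) : (Q.nodeProj j).cls = (P.nodeProj j).cls + if j ∈ I then r else 0 := by
  rw [Proto.nodeProj_cls, Proto.nodeProj_cls, h.other j hj, Proto.inProj_cls_eq h.occs, add_assoc]

end Nodes

/-! ### Projections of configurations -/

section NetStates

variable {Id : Type u}

namespace NetState

/-- The nodes of the domain, in the order of the projection. -/
noncomputable def ids (Δ : NetState Id) : List Id := Δ.map.entries.toList.map Sigma.fst

theorem nodup_ids (Δ : NetState Id) : Δ.ids.Nodup := by
  have h := Δ.map.nodupKeys.nodup_keys
  rw [← Multiset.coe_toList Δ.map.entries, Multiset.coe_keys, Multiset.coe_nodup] at h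
  exact h

theorem ids_ne_nil (Δ : NetState Id) : Δ.ids ≠ [] :=
  fun h => Δ.nonempty (List.map_eq_nil_iff.1 h)

variable [DecidableEq Id]

/-- The state of a node of the domain. -/
noncomputable def stateOf (Δ : NetState Id) (id : Id) : State Id :=
  -- Outside the domain the value is junk: the state of the first entry, which exists because
  -- network states are nonempty.
  (Δ.lookup id).getD (Δ.map.entries.toList.head Δ.nonempty).2

theorem stateOf_eq {Δ : NetState Id} {id : Id} {s : State Id} (h : Δ.lookup id = some s) :
    Δ.stateOf id = s := by
  simp [stateOf, h]

theorem mem_entries_iff {Δ : NetState Id} {id : Id} {s : State Id} :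
    (⟨id, s⟩ : Σ _ : Id, State Id) ∈ Δ.map.entries.toList ↔ Δ.lookup id = some s := by
  rw [Multiset.mem_toList, lookup, Finmap.lookup_eq_some_iff]

theorem mem_ids_iff {Δ : NetState Id} {id : Id} : id ∈ Δ.ids ↔ ∃ s, Δ.lookup id = some s := by
  simp only [ids, List.mem_map, ← mem_entries_iff]
  constructor
  · rintro ⟨⟨id, s⟩, h, rfl⟩
    exact ⟨s, h⟩
  · rintro ⟨s, h⟩
    exact ⟨_, h, rfl⟩

theorem lookup_of_mem {Δ : NetState Id} {id : Id} (h : id ∈ Δ.ids) :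
    Δ.lookup id = some (Δ.stateOf id) := by
  obtain ⟨s, h⟩ := mem_ids_iff.1 h
  rw [h, stateOf_eq h]

theorem lookup_set (Δ : NetState Id) (id : Id) (s : State Id) (j : Id) :
    (Δ.set id s).lookup j = if j = id then some s else Δ.lookup j := by
  split_ifs with h
  · subst h
    exact Finmap.lookup_insert _
  · exact Finmap.lookup_insert_of_ne _ h

theorem lookup_upd {Label : Type v} (M : Model.{u, v, w} Id Label) (f : Label) (d : Dir)
    (id : Id) (s : State Id) (id' : Id) (s' : State Id) (Δ : NetState Id) (j : Id) :
    (Δ.upd M f d id s id' s').lookup j =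
      if j = id' then some (M.effIn f d s' id)
      else if j = id then some (M.effOut f d s id') else Δ.lookup j := by
  simp only [upd, lookup_set]

end NetState

variable [DecidableEq Id] {Label : Type v} {Cond : Type w}

/-- Indexing the nodes by identifiers rather than by entries keeps the index list fixed while states
change, as `ListStep` requires. -/
theorem netProj_eq (Δ : NetState Id) (P : Proto Id Label Cond) :
    netProj Δ P = Network.ofList (Δ.ids.map fun id => .node (Δ.stateOf id) (P.nodeProj id))
      (fun h => Δ.ids_ne_nil (List.map_eq_nil_iff.1 h)) := by
  refine Network.ofList_congr ?_ _ _
  rw [NetState.ids, List.map_map]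
  refine List.map_congr_left ?_
  rintro ⟨id, s⟩ h
  simp [NetState.stateOf_eq (NetState.mem_entries_iff.1 h)]

theorem NCong.netProj {Δ Δ' : NetState Id} {Q : Proto Id Label Cond}
    {g : Id → Network Id Label Cond} (hdom : ∀ id, id ∈ Δ'.ids ↔ id ∈ Δ.ids)
    (H : ∀ id ∈ Δ.ids, ∃ D, g id = .node (Δ'.stateOf id) D ∧ D.cls = (Q.nodeProj id).cls)
    (h : Δ.ids.map g ≠ []) : NCong (Network.ofList (Δ.ids.map g) h) (netProj Δ' Q) := by
  rw [netProj_eq]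
  have p : Δ.ids.Perm Δ'.ids :=
    (List.perm_ext_iff_of_nodup Δ.nodup_ids Δ'.nodup_ids).2 fun id => (hdom id).symm
  refine (NCong.ofList_map (g' := fun id => .node (Δ'.stateOf id) (Q.nodeProj id)) _ ?_ h ?_).trans
    (NCong.ofList_perm (p.map _) _ _)
  · intro id hid
    obtain ⟨D, e, e'⟩ := H id hid
    rw [e]
    exact .node _ (Defn.cls_eq.1 e')
  · exact fun h => Δ.ids_ne_nil (List.map_eq_nil_iff.1 h)

end NetStates

/-! ### Operational correspondence -/

section Correspondence

variable {Id : Type u} {Label : Type v} [DecidableEq Id] {M : Model.{u, v, w} Id Label}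
  {Δ : NetState Id} {P Q : Proto Id Label M.Cond} {id id' : Id} {f : Label} {d : Dir}
  {o i : M.Cond} {I : List Id} {r a : DClass Label M.Cond} {g : Id → Network Id Label M.Cond}

/-- The end of the binary case in both directions of the theorem. As `id ≠ id'`, the continuation
`r` goes to the reacting node alone, and the enabling node keeps its inputs and the residual `a`. -/
theorem Effect.ncong_upd (hE : Effect (fun _ => .nil) id f d o i [id'] r a P Q)
    (hid : id ∈ Δ.ids) (hid' : id' ∈ Δ.ids) (hne : id ≠ id')
    (h₁ : ∃ D, g id = .node (M.effOut f d (Δ.stateOf id) id') D ∧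
      D.cls = (P.inProj fun _ => .nil).cls + a)
    (h₂ : ∃ D, g id' = .node (M.effIn f d (Δ.stateOf id') id) D ∧
      D.cls = (P.nodeProj id').cls + r)
    (h₃ : ∀ j ∈ Δ.ids, j ≠ id → j ≠ id' → g j = .node (Δ.stateOf j) (P.nodeProj j))
    (h : Δ.ids.map g ≠ []) :
    NCong (Network.ofList (Δ.ids.map g) h)
      (netProj (Δ.upd M f d id (Δ.stateOf id) id' (Δ.stateOf id')) Q) := by
  refine NCong.netProj ?_ ?_ h
  · intro j
    rw [NetState.mem_ids_iff, NetState.lookup_upd]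
    split_ifs with e e'
    · subst e; simp [hid']
    · subst e'; simp [hid]
    · rw [NetState.mem_ids_iff]
  · intro j hj
    have hl := NetState.lookup_upd M f d id (Δ.stateOf id) id' (Δ.stateOf id') Δ j
    by_cases e' : j = id'
    · subst e'
      rw [if_pos rfl] at hl
      rw [NetState.stateOf_eq hl, hE.nodeProj_other hne.symm]
      simpa using h₂
    · rw [if_neg e'] at hl
      by_cases e : j = id
      · subst e
        rw [if_pos rfl] at hl
        rw [NetState.stateOf_eq hl, hE.nodeProj_self]
        simpa [hne] using h₁
      · rw [if_neg e, NetState.lookup_of_mem hj] at hl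
        rw [NetState.stateOf_eq hl, hE.nodeProj_other e]
        exact ⟨_, h₃ j hj e e', by simp [e']⟩

/-- The counterpart for broadcasts and local steps, which leave the network state unchanged. -/
theorem Effect.ncong (hE : Effect (fun _ => .nil) id f d o i I r a P Q)
    (H : ∀ j ∈ Δ.ids, ∃ D, g j = .node (Δ.stateOf j) D ∧
      D.cls = (if j = id then (P.inProj fun _ => .nil).cls + a else (P.nodeProj j).cls) +
        if j ∈ I then r else 0)
    (h : Δ.ids.map g ≠ []) :
    NCong (Network.ofList (Δ.ids.map g) h) (netProj Δ Q) := by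
  refine NCong.netProj (fun _ => Iff.rfl) (fun j hj => ?_) h
  obtain ⟨D, e, e'⟩ := H j hj
  refine ⟨D, e, e'.trans ?_⟩
  by_cases hj : j = id
  · subst hj
    rw [if_pos rfl, hE.nodeProj_self]
  · rw [if_neg hj, hE.nodeProj_other hj]

theorem Red.sound (hΔ : Δ.WellFormed) (hP : P.WellFormed M) {Δ' : NetState Id}
    (h : Red M Δ P Δ' Q) : ∃ (l : NLabel Id Label) (N : Network Id Label M.Cond),
      l.IsObservable ∧ NStep M (netProj Δ P) l N ∧ NCong N (netProj Δ' Q) := by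
  obtain ⟨hG, hR, hC⟩ := hP.invariants
  obtain ⟨id, f, d, o, i, I, hEn, hA⟩ := h.exists_actStep
  obtain ⟨r, A, hO, hE⟩ := hA.effect hEn.nodup hG hR fun _ => .nil
  obtain ⟨s, hs, ho, hEn⟩ := hEn
  have hid : id ∈ Δ.ids := NetState.mem_ids_iff.2 ⟨s, hs⟩
  have hself := (hΔ id s hs).1
  have hsource := (hΔ id s hs).2
  obtain rfl := NetState.stateOf_eq hs
  have hout := Proto.nodeProj_out hO
  have ne : ∀ g : Id → Network Id Label M.Cond, Δ.ids.map g ≠ [] :=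
    fun g h => Δ.ids_ne_nil (List.map_eq_nil_iff.1 h)
  rw [netProj_eq]
  rcases hEn with ⟨id', s', hd, hs', hi, hne, rfl, rfl⟩ | ⟨rfl, hI, hI', eΔ⟩ | ⟨rfl, hi, rfl, eΔ⟩
  · have hid' : id' ∈ Δ.ids := NetState.mem_ids_iff.2 ⟨s', hs'⟩
    have hself' := (hΔ id' s' hs').1
    obtain rfl := NetState.stateOf_eq hs'
    obtain ⟨D, hD, eD⟩ := Proto.nodeProj_inp hE.mem id'
    let g' : Id → Network Id Label M.Cond := fun j =>
      if j = id then .node (M.effOut f d (Δ.stateOf id) id') (.par (P.inProj fun _ => .nil) A)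
      else if j = id' then .node (M.effIn f d (Δ.stateOf id') id) D
      else .node (Δ.stateOf j) (P.nodeProj j)
    refine ⟨.tau, .ofList (Δ.ids.map g') (ne _), trivial, ListStep.nstep Δ.nodup_ids ?_, ?_⟩
    · refine .inr ⟨id, hid, id', hid', hne, id, id', f, ?_, ?_, ?_⟩
      · have := NStep.node_send hd hout ho
        rw [hself] at this
        simpa [g'] using this
      · have := NStep.iBin (id := id) hd.up_or_right hD hi
        rw [hself'] at this
        simpa [g', hne.symm] using this
      · intro j _ h₁ h₂
        simp [g', h₁, h₂]
    · refine hE.ncong_upd hid hid' hne ⟨_, by simp only [g', if_true], rfl⟩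
        ⟨_, by simp [g', hne.symm], eD⟩ ?_ (ne g')
      intro j _ h₁ h₂
      simp [g', h₁, h₂]
  · rw [eΔ]
    -- No node is its own parent, so the sender does not receive its own broadcast.
    have hidI : id ∉ I := by
      intro h
      obtain ⟨s, h, e, -⟩ := (hI' id).1 h
      rw [← NetState.stateOf_eq h] at e
      exact hsource e
    choose D hD eD using Proto.nodeProj_inp hE.mem
    let g' : Id → Network Id Label M.Cond := fun j =>
      if j = id then .node (Δ.stateOf id) (.par (P.inProj fun _ => .nil) A)
      else if j ∈ I then .node (Δ.stateOf j) (D j)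
      else .node (Δ.stateOf j) (P.nodeProj j)
    refine ⟨.bsend id f, .ofList (Δ.ids.map g') (ne _), trivial,
      ListStep.nstep Δ.nodup_ids ?_, ?_⟩
    · refine ⟨id, hid, ?_, fun j hj hne => ?_⟩
      · have := NStep.oBrd hout ho
        rw [hself] at this
        simpa [g'] using this
      · by_cases hjI : j ∈ I
        · obtain ⟨s, h, e, hi⟩ := (hI' j).1 hjI
          obtain rfl := NetState.stateOf_eq h
          have := NStep.iBrd (hD j) hi
          rw [e] at this
          simpa [g', hne, hjI] using this
        · simp only [g', hne, hjI, if_false]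
          refine .dBrd ?_
          -- A node outside `I` must be able to discard. By coherence any of its inputs on `f`
          -- carries the condition `i` of the redex, so a child of `id` that could react would be in
          -- `I`.
          rintro ⟨e, c, D', h, hc⟩
          obtain ⟨o', r', hx, -⟩ := Proto.nodeProj_inp_inv h
          have := hC _ hx _ hE.mem rfl
          simp only [Prod.mk.injEq] at this
          obtain ⟨-, -, -, rfl, -⟩ := this
          exact hjI ((hI' j).2 ⟨_, NetState.lookup_of_mem hj, e, hc⟩)
    · refine hE.ncong (fun j hj => ?_) (ne g')
      by_cases e : j = id
      · subst e
        exact ⟨.par (P.inProj fun _ => .nil) A, by simp [g'], by simp [hidI]⟩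
      · by_cases hjI : j ∈ I
        · exact ⟨D j, by simp [g', e, hjI], by simp [eD, e, hjI]⟩
        · exact ⟨P.nodeProj j, by simp [g', e, hjI], by simp [e, hjI]⟩
  · rw [eΔ]
    obtain ⟨D, hD, eD⟩ := Proto.nodeProj_loc hO hE.mem
    let g' : Id → Network Id Label M.Cond := fun j =>
      if j = id then .node (Δ.stateOf id) D else .node (Δ.stateOf j) (P.nodeProj j)
    refine ⟨.tau, .ofList (Δ.ids.map g') (ne _), trivial, ListStep.nstep Δ.nodup_ids ?_, ?_⟩
    · refine .inl ⟨id, hid, ?_, fun j _ h => by simp [g', h]⟩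
      have := NStep.loc hD ((M.sat_conj _ _ _).2 ⟨ho, hi⟩)
      simpa [g'] using this
    · refine hE.ncong (fun j hj => ?_) (ne g')
      by_cases e : j = id
      · subst e
        exact ⟨D, by simp [g'], by simp [eD]⟩
      · exact ⟨P.nodeProj j, by simp [g', e], by simp [e]⟩

theorem NStep.complete (hΔ : Δ.WellFormed) (hP : P.WellFormed M) {l : NLabel Id Label}
    {N : Network Id Label M.Cond} (hl : l.IsObservable) (h : NStep M (netProj Δ P) l N) :
    ∃ (Δ' : NetState Id) (Q : Proto Id Label M.Cond), Red M Δ P Δ' Q ∧ NCong N (netProj Δ' Q) := by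
  obtain ⟨hG, hR, hC⟩ := hP.invariants
  have wf : ∀ j ∈ Δ.ids, (Δ.stateOf j).self = j ∧ (Δ.stateOf j).source ≠ j :=
    fun j hj => hΔ j _ (NetState.lookup_of_mem hj)
  rw [netProj_eq] at h
  obtain ⟨g', h₁, rfl, hL⟩ := NStep.exists_listStep Δ.nodup_ids h
  have local_step : ∀ id ∈ Δ.ids,
      NStep M (.node (Δ.stateOf id) (P.nodeProj id)) .tau (g' id) →
      (∀ j ∈ Δ.ids, j ≠ id → g' j = .node (Δ.stateOf j) (P.nodeProj j)) →
      ∃ (Δ' : NetState Id) (Q : Proto Id Label M.Cond), Red M Δ P Δ' Q ∧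
        NCong (.ofList (Δ.ids.map g') h₁) (netProj Δ' Q) := by
    intro id hid h H
    obtain ⟨c, f, D, hD, hc, eN⟩ := h.node_tau_inv
    obtain ⟨o, o', i, r, A, rfl, hA, hx, eD⟩ := Proto.nodeProj_loc_inv hD
    obtain ⟨i', r', hred⟩ := exists_actStep_of_actProj id _ P (Nat.lt_succ_self _) hG hR hA
    obtain ⟨Q, hQ, hE, -⟩ := hred [id] (by simp)
    -- The local label only tells that output and input share `f`. Coherence identifies the action
    -- behind the input with the contracted redex, so that conditions and continuations agree.
    have := hC _ hx _ hE.mem rfl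
    simp only [Prod.mk.injEq] at this
    obtain ⟨-, -, rfl, rfl, rfl⟩ := this
    rw [M.sat_conj] at hc
    refine ⟨Δ, Q, hQ.red ⟨_, NetState.lookup_of_mem hid, hc.1, .inr (.inr ⟨rfl, hc.2, rfl, rfl⟩)⟩, ?_⟩
    refine hE.ncong (fun j hj => ?_) h₁
    by_cases e : j = id
    · subst e
      exact ⟨D, eN, by simp [eD]⟩
    · exact ⟨P.nodeProj j, H j hj e, by simp [e]⟩
  cases l with
  | send | recv | brecv => exact hl.elim
  | tau =>
    rcases hL with ⟨id, hid, h, H⟩ | ⟨id, hid, id', hid', hne, j, j', f, h, h', H⟩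
    · exact local_step id hid h H
    · obtain ⟨e, o, d, D, hd, hD, ho, eN⟩ := h.node_send_inv
      obtain ⟨e', i, d', D', hD', hi, eN'⟩ := h'.node_recv_inv
      rw [(wf id hid).1] at e
      rw [(wf id' hid').1] at e'
      subst e e'
      obtain ⟨A, hA, eD⟩ := Proto.nodeProj_out_inv hD
      obtain ⟨o', r, hx, eD'⟩ := Proto.nodeProj_inp_inv hD'
      obtain ⟨i', r', hred⟩ := exists_actStep_of_actProj id _ P (Nat.lt_succ_self _) hG hR hA
      obtain ⟨Q, hQ, hE, -⟩ := hred [id'] (by simp)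
      -- The network labels of a binary link do not show the direction. Coherence forces the input
      -- to have the direction of the output, besides the condition and the continuation of the
      -- redex.
      have := hC _ hx _ hE.mem rfl
      simp only [Prod.mk.injEq] at this
      obtain ⟨-, rfl, rfl, rfl, rfl⟩ := this
      refine ⟨_, Q, hQ.red ⟨_, NetState.lookup_of_mem hid, ho, .inl ⟨id', _, hd,
        NetState.lookup_of_mem hid', hi, hne, rfl, rfl⟩⟩, ?_⟩
      exact hE.ncong_upd hid hid' hne ⟨D, eN, eD⟩ ⟨D', eN', eD'⟩ H h₁
  | bsend j f =>
    obtain ⟨id, hid, h, H⟩ := hL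
    obtain ⟨e, o, D, hD, ho, eN⟩ := h.node_bsend_inv
    rw [(wf id hid).1] at e
    subst e
    obtain ⟨A, hA, eD⟩ := Proto.nodeProj_out_inv hD
    obtain ⟨i, r, hred⟩ := exists_actStep_of_actProj id _ P (Nat.lt_succ_self _) hG hR hA
    classical
    -- The condition `i` is that of the redex behind the output. The receivers are determined by it,
    -- before the contraction is carried out.
    let I := Δ.ids.filter fun j => (Δ.stateOf j).source = id ∧ M.Sat (Δ.stateOf j) i
    have hI : I.Nodup := Δ.nodup_ids.filter _
    have hmem : ∀ j, j ∈ I ↔ j ∈ Δ.ids ∧ (Δ.stateOf j).source = id ∧ M.Sat (Δ.stateOf j) i := by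
      intro j
      simp [I]
    obtain ⟨Q, hQ, hE, -⟩ := hred I hI
    refine ⟨Δ, Q, hQ.red ⟨_, NetState.lookup_of_mem hid, ho, .inr (.inl ⟨rfl, hI, ?_, rfl⟩)⟩, ?_⟩
    · intro j
      rw [hmem]
      constructor
      · rintro ⟨hj, e, hi⟩
        exact ⟨_, NetState.lookup_of_mem hj, e, hi⟩
      · rintro ⟨s, hs, e, hi⟩
        obtain rfl := NetState.stateOf_eq hs
        exact ⟨NetState.mem_ids_iff.2 ⟨_, hs⟩, e, hi⟩
    · refine hE.ncong (fun j hj => ?_) h₁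
      by_cases e : j = id
      · subst e
        have : j ∉ I := fun h => (wf j hid).2 ((hmem j).1 h).2.1
        exact ⟨D, eN, by simp [eD, this]⟩
      -- A node that reacts belongs to `I`, since by coherence its input has condition `i`. A node
      -- that discards does not, since the reactive projection offers this input at every node.
      · rcases (H j hj e).node_brecv_inv with ⟨es, c, D', hD', hc, eN'⟩ | ⟨hdis, eN'⟩
        · obtain ⟨o', r', hx, eD'⟩ := Proto.nodeProj_inp_inv hD'
          have := hC _ hx _ hE.mem rfl
          simp only [Prod.mk.injEq] at this
          obtain ⟨-, -, -, rfl, rfl⟩ := this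
          have : j ∈ I := (hmem j).2 ⟨hj, es, hc⟩
          exact ⟨D', eN', by simp [eD', e, this]⟩
        · have : j ∉ I := by
            intro h
            obtain ⟨-, es, hi⟩ := (hmem j).1 h
            obtain ⟨D', hD', -⟩ := Proto.nodeProj_inp hE.mem j
            exact hdis ⟨es, i, D', hD', hi⟩
          exact ⟨P.nodeProj j, eN', by simp [e, this]⟩

end Correspondence

end OpControl

theorem theorem1 {Id : Type u} {Label : Type v} [DecidableEq Id]
    (M : OpControl.Model.{u, v, w} Id Label)
    (Δ : OpControl.NetState Id) (P : OpControl.Proto Id Label M.Cond)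
    (hΔ : Δ.WellFormed) (hP : P.WellFormed M) :
    (∀ (Δ' : OpControl.NetState Id) (Q : OpControl.Proto Id Label M.Cond),
      OpControl.Red M Δ P Δ' Q →
        ∃ (l : OpControl.NLabel Id Label) (N : OpControl.Network Id Label M.Cond),
          l.IsObservable ∧
          OpControl.NStep M (OpControl.netProj Δ P) l N ∧
          OpControl.NCong N (OpControl.netProj Δ' Q)) ∧
    (∀ (l : OpControl.NLabel Id Label) (N : OpControl.Network Id Label M.Cond),
      l.IsObservable →
      OpControl.NStep M (OpControl.netProj Δ P) l N →
        ∃ (Δ' : OpControl.NetState Id) (Q : OpControl.Proto Id Label M.Cond),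
          OpControl.Red M Δ P Δ' Q ∧
          OpControl.NCong N (OpControl.netProj Δ' Q)) :=
  ⟨fun _ _ h => h.sound hΔ hP, fun _ _ hl h => h.complete hΔ hP hl⟩
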